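/- \textbf{Conventions.} For $a\in\mathbb F_2^n$ let $X(a)=\bigotimes_i X^{a_i}$ and $Z(a)=\bigotimes_i Z^{a_i}$. A \emph{CSS observable} on $n$ qubits is one of the operators $\pm X(a)$ ($X$-type), $\pm Z(a)$ ($Z$-type); $P(S)=\tfrac12(\mathbb 1+S)$ is the projector onto its $+1$ eigenspace. A \emph{pure CSS state} on $n$ qubits is a unit vector whose stabilizer group is generated by $n$ independent commuting CSS observables (on $0$ qubits: the state $1$); a \emph{CSS state} is a convex combination of the projectors $|\psi\rangle\langle\psi|$ of pure CSS states $|\psi\rangle$. A unitary $U$ (and its channel $\mathcal U=U(\cdot)U^\dagger$) is \emph{completely CSS-preserving} if $\mathcal I_A\otimes\mathcal U$ maps CSS states to CSS states for every additional system $A$ of finitely many qubits. A \emph{CSS circuit} is a statistical mixture of sequences of the following primitive operations: (1) introducing a CSS state on any number of qubits; (2) performing a completely CSS-preserving unitary; (3) projectively measuring a CSS observable, where the subsequent operations may depend on the outcome; (4) discarding any number of qubits. For $n>k'\ge 0$, an \emph{$[[n,k']]$ CSS code} is the joint $+1$ eigenspace of independent commuting CSS observables $S_1,\dots,S_{n-k'}$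 on $n$ qubits, none of them the identity, that generate a group not containing $-\mathbb 1$. A \emph{code projection} of it is a map from $n$ to $k'$ qubits of the form $$\mathcal K(\rho)=\mathrm{tr}_{k'+1,\dots,n}\big[V^\dagger P\rho P\,V\big],\qquad P=\prod_{i=1}^{n-k'}P(S_i),$$ where $V$ is a completely CSS-preserving encoding unitary, i.e. $V^\dagger S_iV=Z_{k'+i}$ if $S_i$ is $Z$-type and $V^\dagger S_iV=X_{k'+i}$ if $S_i$ is $X$-type. \textbf{Theorem.} Let $n\ge 2$ and $1\le k<n$, and let $\mathcal E$ be an $n$-to-$k$ CSS magic distillation protocol, i.e. a CSS circuit with $n$ input qubits and $k$ output qubits. Then there is a finite family of numbers $p_j\in[0,1]$ (not necessarily summing to $1$), integers $0\le k_j\le k$, code projections $\mathcal K_j$ of $[[n,k_j]]$ CSS codes, pure CSS states $|\varphi_j\rangle$ on $k-k_j$ qubits, and completely CSS-preserving unitary channels $\mathcal U_j$ on $k$ qubits, such that for all $\rho$ $$\mathcal E(\rho)=\sum_j p_j\,\mathcal U_j\big(\mathcal K_j(\rho)\otimes|\varphi_j\rangle\langle\varphi_j|\big).$$ -/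

import Mathlib

open scoped Matrix

noncomputable section

namespace CSSDistillation

/-! ### Qubit registers -/

section Registers

variable {ι κ α : Type} [Fintype ι] [DecidableEq ι] [Fintype κ] [DecidableEq κ]

/-- State vectors of a register of qubits labelled by `ι`; the computational basis is
indexed by the bit strings `ι → ZMod 2`. -/
abbrev Ket (ι : Type) : Type := (ι → ZMod 2) → ℂ

/-- Operators on a register of qubits labelled by `ι`, as matrices in the computational basis. -/
abbrev Op (ι : Type) : Type := Matrix (ι → ZMod 2) (ι → ZMod 2) ℂ

/-- The operator `|ψ⟩⟨ψ|`. -/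
def ketbra (ψ : Ket ι) : Op ι := Matrix.vecMulVec ψ (star ψ)

/-- The tensor product `A ⊗ B` on the joint register. -/
def tensor (A : Op ι) (B : Op κ) : Op (ι ⊕ κ) :=
  Matrix.of fun x y => A (x ∘ Sum.inl) (y ∘ Sum.inl) * B (x ∘ Sum.inr) (y ∘ Sum.inr)

/-- The partial trace over the second register. -/
def partialTrace (M : Op (ι ⊕ κ)) : Op ι :=
  Matrix.of fun x y => ∑ z : κ → ZMod 2, M (Sum.elim x z) (Sum.elim y z)

/-- Renaming the qubits of a register along a bijection. -/
def relabel (e : ι ≃ κ) (M : Op ι) : Op κ :=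
  Matrix.of fun x y => M (x ∘ e) (y ∘ e)

/-- The map `𝓘_A ⊗ 𝓔_B` for a (linear) map `𝓔`, applied block by block. -/
def idTensor (α : Type) (E : Op ι → Op κ) (M : Op (α ⊕ ι)) : Op (α ⊕ κ) :=
  Matrix.of fun x y =>
    E (Matrix.of fun b b' => M (Sum.elim (x ∘ Sum.inl) b) (Sum.elim (y ∘ Sum.inl) b'))
      (x ∘ Sum.inr) (y ∘ Sum.inr)

/-- The conjugation `ρ ↦ U ρ U†`. -/
def conjBy (U : Op ι) (ρ : Op ι) : Op ι := U * ρ * Uᴴ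

/-! ### CSS observables, CSS states, completely CSS-preserving unitaries -/

/-- `X(a)`: the Pauli `X` on each qubit `i` with `a i = 1`, identity elsewhere. -/
def pauliX (a : ι → ZMod 2) : Op ι :=
  Matrix.of fun x y => if x = y + a then 1 else 0

/-- `Z(a)`: the Pauli `Z` on each qubit `i` with `a i = 1`, identity elsewhere. -/
def pauliZ (a : ι → ZMod 2) : Op ι :=
  Matrix.diagonal fun x => (-1 : ℂ) ^ (∑ i, a i * x i).val

/-- `X`-type Pauli observables `± X(a)`. -/
def IsXType (S : Op ι) : Prop := ∃ a : ι → ZMod 2, S = pauliX a ∨ S = -pauliX a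

/-- `Z`-type Pauli observables `± Z(a)`. -/
def IsZType (S : Op ι) : Prop := ∃ a : ι → ZMod 2, S = pauliZ a ∨ S = -pauliZ a

/-- CSS observables. -/
def IsCSSObservable (S : Op ι) : Prop := IsXType S ∨ IsZType S

/-- The projector `P(S) = (1 + S) / 2` onto the `+1` eigenspace of an observable `S`. -/
def posProj (S : Op ι) : Op ι := (1 / 2 : ℂ) • (1 + S)

/-- The `S i` are independent and commuting CSS observables, none the identity, and the group
that they generate does not contain `-1`.  (Each `S i` is its own inverse, so that group is the
submonoid generated by the `S i`.) -/
structure IsCSSGenerators {τ : Type} (S : τ → Op ι) : Prop where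
  css : ∀ i, IsCSSObservable (S i)
  ne_one : ∀ i, S i ≠ 1
  commute : ∀ i j, Commute (S i) (S j)
  independent : ∀ i, S i ∉ Submonoid.closure (S '' {j | j ≠ i})
  neg_one_notMem : (-1 : Op ι) ∉ Submonoid.closure (Set.range S)

/-- Pure CSS states: unit vectors whose stabilizer group is generated by as many independent CSS
observables as there are qubits. The state `1` of the empty register is included. -/
def IsPureCSSState (ψ : Ket ι) : Prop :=
  ∑ x, ‖ψ x‖ ^ 2 = 1 ∧
    ∃ S : ι → Op ι, IsCSSGenerators S ∧ ∀ i, S i *ᵥ ψ = ψ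

/-- CSS states: the convex hull of the pure CSS states. -/
def IsCSSState (ρ : Op ι) : Prop :=
  ρ ∈ convexHull ℝ {σ : Op ι | ∃ ψ : Ket ι, IsPureCSSState ψ ∧ σ = ketbra ψ}

/-- `𝓔` is completely CSS-preserving: `𝓘_A ⊗ 𝓔_B` maps CSS states to CSS states, for every
further system `A` of qubits. -/
def IsCompletelyCSSPreserving (E : Op ι → Op κ) : Prop :=
  ∀ (m : ℕ) (ρ : Op (Fin m ⊕ ι)), IsCSSState ρ → IsCSSState (idTensor (Fin m) E ρ)

/-- Unitaries whose channel `ρ ↦ U ρ U†` is completely CSS-preserving. -/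
def IsCompletelyCSSPreservingUnitary (U : Op ι) : Prop :=
  U ∈ Matrix.unitaryGroup (ι → ZMod 2) ℂ ∧ IsCompletelyCSSPreserving (conjBy U)

end Registers

/-! ### CSS circuits -/

/-- Sequences of primitive CSS channels from `n` to `k` qubits, with the channel that each of
them performs. Every constructor puts one primitive channel in front of a sequence.
A gate or an observable on some of the qubits is, after tensoring with the identity,
a completely CSS-preserving unitary or a CSS observable on the whole register. -/
inductive IsCSSSequence : {n k : ℕ} → (Op (Fin n) → Op (Fin k)) → Prop
  /-- The empty sequence. -/
  | done {n : ℕ} : IsCSSSequence (fun ρ : Op (Fin n) => ρ)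
  /-- Introduce `m` qubits in a CSS state `σ`. -/
  | introduce {n m k : ℕ} (σ : Op (Fin m)) (hσ : IsCSSState σ)
      (E : Op (Fin (n + m)) → Op (Fin k)) (hE : IsCSSSequence E) :
      IsCSSSequence (fun ρ : Op (Fin n) => E (relabel finSumFinEquiv (tensor ρ σ)))
  /-- Perform a completely CSS-preserving unitary. -/
  | gate {n k : ℕ} (U : Op (Fin n)) (hU : IsCompletelyCSSPreservingUnitary U)
      (E : Op (Fin n) → Op (Fin k)) (hE : IsCSSSequence E) :
      IsCSSSequence (fun ρ : Op (Fin n) => E (conjBy U ρ))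
  /-- Measure a CSS observable `S` projectively and go on with a sequence that may depend
  on the outcome. -/
  | measure {n k : ℕ} (S : Op (Fin n)) (hS : IsCSSObservable S)
      (E₁ E₂ : Op (Fin n) → Op (Fin k)) (hE₁ : IsCSSSequence E₁) (hE₂ : IsCSSSequence E₂) :
      IsCSSSequence (fun ρ : Op (Fin n) =>
        E₁ (posProj S * ρ * posProj S) + E₂ (posProj (-S) * ρ * posProj (-S)))
  /-- Discard any `l` of the qubits, namely those that `e` labels by the second summand. -/
  | discard {n m l k : ℕ} (e : Fin m ⊕ Fin l ≃ Fin n)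
      (E : Op (Fin m) → Op (Fin k)) (hE : IsCSSSequence E) :
      IsCSSSequence (fun ρ : Op (Fin n) => E (partialTrace (relabel e.symm ρ)))

/-- CSS circuits: statistical mixtures of sequences of primitive CSS channels. -/
def IsCSSCircuit {n k : ℕ} (E : Op (Fin n) → Op (Fin k)) : Prop :=
  ∃ (r : ℕ) (q : Fin r → ℝ) (F : Fin r → Op (Fin n) → Op (Fin k)),
    (∀ i, 0 ≤ q i) ∧ ∑ i, q i = 1 ∧ (∀ i, IsCSSSequence (F i)) ∧
      ∀ ρ, E ρ = ∑ i, q i • F i ρ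

/-! ### CSS codes and their code projections -/

/-- The first `k` and the last `n - k` of `n` qubits. -/
def split {k n : ℕ} (h : k ≤ n) : Fin k ⊕ Fin (n - k) ≃ Fin n :=
  finSumFinEquiv.trans (finCongr (Nat.add_sub_of_le h))

/-- An `[[n, k]]` CSS code, given by `n - k` CSS observables that generate its stabilizer. -/
structure CSSCode (n k : ℕ) where
  lt : k < n
  gen : Fin (n - k) → Op (Fin n)
  isGen : IsCSSGenerators gen

namespace CSSCode

variable {n k : ℕ} (C : CSSCode n k)

/-- The projector `P = ∏ P(S_i)` onto the codespace. -/
def projector : Op (Fin n) := (List.ofFn fun i => posProj (C.gen i)).prod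

/-- `U` is a completely CSS-preserving encoding unitary: `U† S_i U` is `Z` or `X` on the qubit
`k + i`, according to the type of `S_i`. -/
structure IsEncodingUnitary (U : Op (Fin n)) : Prop where
  preserving : IsCompletelyCSSPreservingUnitary U
  zType : ∀ i, IsZType (C.gen i) →
    Uᴴ * C.gen i * U = pauliZ (Pi.single (split C.lt.le (Sum.inr i)) 1)
  xType : ∀ i, IsXType (C.gen i) →
    Uᴴ * C.gen i * U = pauliX (Pi.single (split C.lt.le (Sum.inr i)) 1)

/-- The code projection `𝓚(ρ) = tr_{k+1,…,n} [U† P ρ P U]`: project onto the code, decode with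
`U†` onto the first `k` qubits, discard the others. -/
def codeProjection (U : Op (Fin n)) (ρ : Op (Fin n)) : Op (Fin k) :=
  partialTrace (relabel (split C.lt.le).symm (Uᴴ * (C.projector * ρ * C.projector) * U))

end CSSCode

end CSSDistillation

end

set_option linter.unusedSectionVars false

noncomputable section

namespace CSSDistillation

/-! The proof describes every CSS circuit by Kraus operators of one special shape and then brings a
single Kraus operator into normal form. The shape: read as a function of the pair (output string,
input string), the matrix is a constant times a sign character on an affine subspace, and zero
elsewhere. `IsAffineSign` states this through translations, which makes closure properties short to
prove. The amplitudes of pure CSS states have this shape (`IsPureCSSState.isAffineSign`), matrix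
products preserve it (`IsAffineSignMatrix.mul`), and it holds for the Kraus operators of every
primitive. For a completely CSS-preserving unitary the reason is the Choi correspondence: acting on
half of Bell pairs, it gives a CSS state whose amplitudes are its matrix entries up to scale
(`IsCompletelyCSSPreservingUnitary.isAffineSignMatrix`). Hence a circuit is a finite sum of maps
`krausMap K` (`IsCSSCircuit.mem_affineKrausMaps`).

For one such `K`, the direction of its support is a linear relation between inputs and outputs.
Linear changes of basis on both sides turn the relation into equality of `r` coordinates, with every
other coordinate either free or zero (`exists_linear_relation_normal_form`). Free coordinates
correspond to `|+⟩` and zero ones to `|0⟩`. Thus, up to a scalar and affine unitaries on both sides,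
`K` projects `n - r` input qubits onto `|+⟩` or `|0⟩`, keeps `r` qubits, and prepares `k - r` output
qubits in `|+⟩` or `|0⟩` (`IsAffineSignMatrix.exists_eq_standardKraus`). This is a code projection
followed by the preparation of a CSS state and a unitary. Since `r ≤ k < n`, the code has at least
one generator. A weight above one is distributed over several equal terms. -/

/-- Complex functions on an abelian group that are invariant up to a sign under all differences of
points of their support.  On `𝔽₂ⁿ` these are the multiples of a sign character
restricted to an affine subspace. -/
def IsAffineSign {G : Type*} [AddCommGroup G] (f : G → ℂ) : Prop :=
  ∀ x y, f x ≠ 0 → f y ≠ 0 → ∃ ε : ℂ, (ε = 1 ∨ ε = -1) ∧ ∀ z, f (z + (x - y)) = ε * f z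

/-! ### Closure properties of affine sign functions and matrices -/

section AffineSign

variable {G H : Type*} [AddCommGroup G] [AddCommGroup H]

theorem IsAffineSign.comp {f : G → ℂ} (hf : IsAffineSign f) (A : H →+ G) :
    IsAffineSign fun x => f (A x) := by
  intro x y hx hy
  obtain ⟨ε, hε, h⟩ := hf _ _ hx hy
  exact ⟨ε, hε, fun z => by simp [h]⟩

theorem sign_mul {ε δ : ℂ} (hε : ε = 1 ∨ ε = -1) (hδ : δ = 1 ∨ δ = -1) :
    ε * δ = 1 ∨ ε * δ = -1 := by
  rcases hε with rfl | rfl <;> rcases hδ with rfl | rfl <;> simp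

theorem IsAffineSign.mul {f g : G → ℂ} (hf : IsAffineSign f) (hg : IsAffineSign g) :
    IsAffineSign fun x => f x * g x := by
  intro x y hx hy
  obtain ⟨ε, hε, h⟩ := hf x y (left_ne_zero_of_mul hx) (left_ne_zero_of_mul hy)
  obtain ⟨δ, hδ, h'⟩ := hg x y (right_ne_zero_of_mul hx) (right_ne_zero_of_mul hy)
  exact ⟨ε * δ, sign_mul hε hδ, fun z => by simp only [h, h']; ring⟩

theorem IsAffineSign.const_mul {f : G → ℂ} (hf : IsAffineSign f) (c : ℂ) :
    IsAffineSign fun x => c * f x := by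
  intro x y hx hy
  obtain ⟨ε, hε, h⟩ := hf x y (right_ne_zero_of_mul hx) (right_ne_zero_of_mul hy)
  exact ⟨ε, hε, fun z => by simp only [h]; ring⟩

theorem isAffineSign_indicator [DecidableEq H] (A : G →+ H) (s : H) :
    IsAffineSign fun x => if A x = s then (1 : ℂ) else 0 := by
  intro x y hx hy
  have hx' : A x = s := by by_contra h; simp [h] at hx
  have hy' : A y = s := by by_contra h; simp [h] at hy
  exact ⟨1, Or.inl rfl, fun z => by simp [hx', hy']⟩

/-- Matrices whose entries form an affine sign function. -/
def IsAffineSignMatrix {R C : Type*} [AddCommGroup R] [AddCommGroup C] (K : Matrix R C ℂ) : Prop :=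
  IsAffineSign fun p : R × C => K p.1 p.2

/-- A nonzero entry of the product has a nonzero path through some middle index. For two such
entries with middle indices `s` and `s'`, shifting the summation variable by `s - s'` lets the
translation laws of both factors act at once, and their signs multiply. -/
theorem IsAffineSignMatrix.mul {R S T : Type*} [AddCommGroup R] [AddCommGroup S] [AddCommGroup T]
    [Fintype S] {K : Matrix R S ℂ} {L : Matrix S T ℂ} (hK : IsAffineSignMatrix K)
    (hL : IsAffineSignMatrix L) : IsAffineSignMatrix (K * L) := by
  rintro ⟨r, t⟩ ⟨r', t'⟩ h h'
  simp only [Matrix.mul_apply] at h h'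
  obtain ⟨s, -, hs⟩ := Finset.exists_ne_zero_of_sum_ne_zero h
  obtain ⟨s', -, hs'⟩ := Finset.exists_ne_zero_of_sum_ne_zero h'
  obtain ⟨ε, hε, e⟩ := hK (r, s) (r', s') (left_ne_zero_of_mul hs) (left_ne_zero_of_mul hs')
  obtain ⟨δ, hδ, d⟩ := hL (s, t) (s', t') (right_ne_zero_of_mul hs) (right_ne_zero_of_mul hs')
  refine ⟨ε * δ, sign_mul hε hδ, ?_⟩
  rintro ⟨z, w⟩
  simp only [Matrix.mul_apply, Finset.mul_sum]
  rw [← Equiv.sum_comp (Equiv.addRight (s - s'))]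
  refine Finset.sum_congr rfl fun u _ => ?_
  have e' := e (z, u)
  have d' := d (u, w)
  simp only [Prod.mk_sub_mk, Prod.mk_add_mk] at e' d'
  simp only [Prod.mk_sub_mk, Prod.mk_add_mk, Equiv.coe_addRight, e', d']
  ring

theorem IsAffineSignMatrix.smul {R C : Type*} [AddCommGroup R] [AddCommGroup C] {K : Matrix R C ℂ}
    (hK : IsAffineSignMatrix K) (c : ℂ) : IsAffineSignMatrix (c • K) :=
  IsAffineSign.const_mul hK c

end AffineSign

/-! ### Sums of Kraus maps with affine sign matrices -/

section KrausMaps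

variable {ι κ μ : Type} [Fintype ι] [DecidableEq ι] [Fintype κ] [DecidableEq κ]
  [Fintype μ] [DecidableEq μ]

/-- The map `ρ ↦ K ρ K†`. -/
def krausMap (K : Matrix (κ → ZMod 2) (ι → ZMod 2) ℂ) (ρ : Op ι) : Op κ := K * ρ * Kᴴ

variable (ι κ) in
/-- Sums of the maps `ρ ↦ K ρ K†` with affine sign matrices `K`. -/
def affineKrausMaps : AddSubmonoid (Op ι → Op κ) :=
  AddSubmonoid.closure
    {F | ∃ K : Matrix (κ → ZMod 2) (ι → ZMod 2) ℂ, IsAffineSignMatrix K ∧ F = krausMap K}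

theorem krausMap_mem {K : Matrix (κ → ZMod 2) (ι → ZMod 2) ℂ} (hK : IsAffineSignMatrix K) :
    krausMap K ∈ affineKrausMaps ι κ :=
  AddSubmonoid.subset_closure ⟨K, hK, rfl⟩

theorem comp_mem_affineKrausMaps {E : Op κ → Op μ} {F : Op ι → Op κ}
    (hE : E ∈ affineKrausMaps κ μ) (hF : F ∈ affineKrausMaps ι κ) :
    (fun ρ => E (F ρ)) ∈ affineKrausMaps ι μ := by
  induction hE using AddSubmonoid.closure_induction with
  | mem E h =>
    obtain ⟨K, hK, rfl⟩ := h
    induction hF using AddSubmonoid.closure_induction with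
    | mem F h =>
      obtain ⟨L, hL, rfl⟩ := h
      convert krausMap_mem (hK.mul hL) using 1
      funext ρ
      simp [krausMap, Matrix.conjTranspose_mul, Matrix.mul_assoc]
    | zero =>
      convert (affineKrausMaps ι μ).zero_mem using 1
      funext ρ
      simp [krausMap]
    | add F F' _ _ h h' =>
      convert (affineKrausMaps ι μ).add_mem h h' using 1
      funext ρ
      simp [krausMap, Matrix.mul_add, Matrix.add_mul]
  | zero => exact (affineKrausMaps ι μ).zero_mem
  | add E E' _ _ h h' => exact (affineKrausMaps ι μ).add_mem h h'

theorem smul_mem_affineKrausMaps {E : Op ι → Op κ} (hE : E ∈ affineKrausMaps ι κ) {c : ℝ}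
    (hc : 0 ≤ c) : c • E ∈ affineKrausMaps ι κ := by
  induction hE using AddSubmonoid.closure_induction with
  | mem E h =>
    obtain ⟨K, hK, rfl⟩ := h
    -- A Kraus operator enters its map quadratically, so a weight is absorbed through its square
    -- root.
    convert krausMap_mem (hK.smul (Real.sqrt c : ℂ)) using 1
    funext ρ
    simp only [krausMap, Pi.smul_apply, Matrix.conjTranspose_smul, Matrix.smul_mul,
      Matrix.mul_smul, smul_smul]
    have : (Real.sqrt c : ℂ) * Real.sqrt c = c := by
      rw [← Complex.ofReal_mul, Real.mul_self_sqrt hc]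
    simp only [Complex.star_def, Complex.conj_ofReal, this]
    rfl
  | zero => simp [(affineKrausMaps ι κ).zero_mem]
  | add E E' _ _ h h' => rw [smul_add]; exact (affineKrausMaps ι κ).add_mem h h'

end KrausMaps

/-! ### Signs and the Pauli operators -/

/-- The sign `(-1)^a`. -/
def sgn (a : ZMod 2) : ℂ := (-1) ^ a.val

@[simp] theorem sgn_zero : sgn 0 = 1 := by simp [sgn]

@[simp] theorem sgn_one : sgn 1 = -1 := by simp [sgn, ZMod.val_one]

theorem zmod_two_cases (a : ZMod 2) : a = 0 ∨ a = 1 := by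
  revert a; decide

theorem sgn_add (a b : ZMod 2) : sgn (a + b) = sgn a * sgn b := by
  rcases zmod_two_cases a with rfl | rfl <;> rcases zmod_two_cases b with rfl | rfl <;>
    simp [CharTwo.add_self_eq_zero]

theorem sgn_eq (a : ZMod 2) : sgn a = 1 ∨ sgn a = -1 := by
  rcases zmod_two_cases a with rfl | rfl <;> simp

theorem sgn_mul_self (a : ZMod 2) : sgn a * sgn a = 1 := by
  rw [← sgn_add, CharTwo.add_self_eq_zero, sgn_zero]

theorem sgn_injective : Function.Injective sgn := by
  intro a b h
  have key : (1 : ℂ) ≠ -1 := by norm_num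
  rcases zmod_two_cases a with rfl | rfl <;> rcases zmod_two_cases b with rfl | rfl <;>
    simp [key, key.symm] at h ⊢

@[simp] theorem star_sgn (a : ZMod 2) : star (sgn a) = sgn a := by
  rcases sgn_eq a with h | h <;> simp [h]

@[simp] theorem norm_sgn (a : ZMod 2) : ‖sgn a‖ = 1 := by
  rcases sgn_eq a with h | h <;> simp [h]

section Pauli

variable {ι : Type}

theorem bits_add_self (a : ι → ZMod 2) : a + a = 0 := by
  funext i; exact CharTwo.add_self_eq_zero _

theorem bits_add_cancel (x a : ι → ZMod 2) : x + a + a = x := by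
  rw [add_assoc, bits_add_self, add_zero]

theorem bits_eq_add_iff {x y a : ι → ZMod 2} : x = y + a ↔ y = x + a := by
  constructor <;> rintro rfl <;> rw [bits_add_cancel]

theorem bits_sub_eq_add (x a : ι → ZMod 2) : x - a = x + a := by
  funext i; exact CharTwo.sub_eq_add _ _

variable [Fintype ι] [DecidableEq ι]

theorem op_ext_mulVec {R C : Type*} [Fintype C] [DecidableEq C] {M N : Matrix R C ℂ}
    (h : ∀ ψ x, (M *ᵥ ψ) x = (N *ᵥ ψ) x) : M = N := by
  ext x y
  simpa using h (Pi.single y 1) x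

theorem pauliZ_eq (b : ι → ZMod 2) : pauliZ b = Matrix.diagonal fun x => sgn (b ⬝ᵥ x) := rfl

theorem pauliX_mulVec (a : ι → ZMod 2) (ψ : Ket ι) (x : ι → ZMod 2) :
    (pauliX a *ᵥ ψ) x = ψ (x + a) := by
  simp [pauliX, Matrix.mulVec, dotProduct, bits_eq_add_iff (x := x)]

theorem pauliZ_mulVec (b : ι → ZMod 2) (ψ : Ket ι) (x : ι → ZMod 2) :
    (pauliZ b *ᵥ ψ) x = sgn (b ⬝ᵥ x) * ψ x := by
  rw [pauliZ_eq, Matrix.mulVec_diagonal]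

@[simp] theorem pauliX_zero : pauliX (0 : ι → ZMod 2) = 1 :=
  op_ext_mulVec fun ψ x => by simp [pauliX_mulVec]

@[simp] theorem pauliZ_zero : pauliZ (0 : ι → ZMod 2) = 1 :=
  op_ext_mulVec fun ψ x => by simp [pauliZ_mulVec]

theorem pauliX_add (a b : ι → ZMod 2) : pauliX (a + b) = pauliX a * pauliX b :=
  op_ext_mulVec fun ψ x => by
    simp only [← Matrix.mulVec_mulVec, pauliX_mulVec, add_assoc]

theorem pauliZ_add (a b : ι → ZMod 2) : pauliZ (a + b) = pauliZ a * pauliZ b :=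
  op_ext_mulVec fun ψ x => by
    simp only [← Matrix.mulVec_mulVec, pauliZ_mulVec, add_dotProduct, sgn_add, mul_assoc]

theorem pauliX_mul_pauliZ (a b : ι → ZMod 2) :
    pauliX a * pauliZ b = sgn (b ⬝ᵥ a) • (pauliZ b * pauliX a) :=
  op_ext_mulVec fun ψ x => by
    simp only [← Matrix.mulVec_mulVec, pauliX_mulVec, pauliZ_mulVec, dotProduct_add, sgn_add,
      Matrix.smul_mulVec, Pi.smul_apply, smul_eq_mul]
    ring

theorem pauliX_mul_self (a : ι → ZMod 2) : pauliX a * pauliX a = 1 := by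
  rw [← pauliX_add, bits_add_self, pauliX_zero]

theorem pauliZ_mul_self (a : ι → ZMod 2) : pauliZ a * pauliZ a = 1 := by
  rw [← pauliZ_add, bits_add_self, pauliZ_zero]

theorem IsCSSObservable.mul_self {S : Op ι} (h : IsCSSObservable S) : S * S = 1 := by
  rcases h with ⟨a, rfl | rfl⟩ | ⟨a, rfl | rfl⟩ <;> simp [pauliX_mul_self, pauliZ_mul_self]

theorem dotProduct_eq_zero_of_commute {a b : ι → ZMod 2} (h : Commute (pauliX a) (pauliZ b)) :
    b ⬝ᵥ a = 0 := by
  apply sgn_injective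
  have h1 := pauliX_mul_pauliZ a b
  rw [h.eq] at h1
  have h2 := congrArg (fun M => M * (pauliX a * pauliZ b)) h1
  have h3 : pauliZ b * pauliX a * (pauliX a * pauliZ b) = 1 := by
    rw [Matrix.mul_assoc, ← Matrix.mul_assoc (pauliX a), pauliX_mul_self, Matrix.one_mul,
      pauliZ_mul_self]
  simp only [Matrix.smul_mul, h3] at h2
  simpa using (congrFun (congrFun h2 0) 0).symm

end Pauli

/-! ### Amplitudes of pure CSS states -/

section PureStates

variable {ι : Type} [Fintype ι] [DecidableEq ι]

/-- A linear dependence would put `S (g i)` or its negative into the group of the other generators.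
The first contradicts independence; the second, multiplied by `S (g i)`, puts `-1` into the whole
group. `P` stands for `pauliX` or `pauliZ`. -/
theorem linearIndependent_of_isCSSGenerators {τ J : Type} {S : τ → Op ι} (hS : IsCSSGenerators S)
    (P : (ι → ZMod 2) → Op ι) (P_zero : P 0 = 1) (P_add : ∀ a b, P (a + b) = P a * P b)
    (g : J → τ) (hg : Function.Injective g) (v : J → ι → ZMod 2)
    (hv : ∀ j, S (g j) = P (v j) ∨ S (g j) = -P (v j)) :
    LinearIndependent (ZMod 2) v := by
  rw [linearIndependent_iff_notMem_span]
  intro i hi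
  have key : ∀ x ∈ Submodule.span (ZMod 2) (v '' (Set.univ \ {i})),
      P x ∈ Submonoid.closure (S '' {j | j ≠ g i}) ∨
      -P x ∈ Submonoid.closure (S '' {j | j ≠ g i}) := by
    intro x hx
    induction hx using Submodule.span_induction with
    | mem x h =>
      obtain ⟨j, hj, rfl⟩ := h
      have hm : S (g j) ∈ Submonoid.closure (S '' {j | j ≠ g i}) :=
        Submonoid.subset_closure ⟨g j, fun h => hj.2 (hg h), rfl⟩
      rcases hv j with h | h
      · exact Or.inl (h ▸ hm)
      · exact Or.inr (h ▸ hm)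
    | zero => exact Or.inl (P_zero ▸ Submonoid.one_mem _)
    | add x y _ _ hx hy =>
      rw [P_add]
      rcases hx with hx | hx <;> rcases hy with hy | hy <;> have h := Submonoid.mul_mem _ hx hy
      · exact Or.inl h
      · exact Or.inr (by simpa using h)
      · exact Or.inr (by simpa using h)
      · exact Or.inl (by simpa using h)
    | smul c x _ hx =>
      rcases zmod_two_cases c with rfl | rfl
      · rw [zero_smul]; exact Or.inl (P_zero ▸ Submonoid.one_mem _)
      · rwa [one_smul]
  have hneg : -S (g i) ∉ Submonoid.closure (S '' {j | j ≠ g i}) := by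
    intro h
    have h1 := Submonoid.closure_mono (Set.image_subset_range S _) h
    have h2 := Submonoid.mul_mem _ h1 (Submonoid.subset_closure ⟨g i, rfl⟩)
    rw [neg_mul, (hS.css _).mul_self] at h2
    exact hS.neg_one_notMem h2
  have hpos := hS.independent (g i)
  rcases hv i with h | h <;> rcases key _ hi with h' | h' <;> rw [h] at hpos hneg
  · exact hpos h'
  · exact hneg h'
  · exact hneg (by rwa [neg_neg])
  · exact hpos h'

/-- The `Z`-type stabilizers confine differences of support points to the annihilator of their
exponent vectors, and the `X`-type stabilizers give invariance up to sign under the span of theirs.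
With as many generators as qubits, these two subspaces coincide. -/
theorem IsPureCSSState.isAffineSign {ψ : Ket ι} (h : IsPureCSSState ψ) : IsAffineSign ψ := by
  classical
  obtain ⟨-, S, hS, hψ⟩ := h
  have hX : ∀ i : {i // IsXType (S i)}, ∃ a, S i = pauliX a ∨ S i = -pauliX a := fun i => i.2
  have hZ : ∀ i : {i // ¬ IsXType (S i)}, ∃ b, S i = pauliZ b ∨ S i = -pauliZ b :=
    fun i => (hS.css i).resolve_left i.2
  choose a ha using hX
  choose b hb using hZ
  have la := linearIndependent_of_isCSSGenerators hS pauliX pauliX_zero pauliX_add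
    Subtype.val Subtype.val_injective a ha
  have lb := linearIndependent_of_isCSSGenerators hS pauliZ pauliZ_zero pauliZ_add
    Subtype.val Subtype.val_injective b hb
  have hab : ∀ i j, b j ⬝ᵥ a i = 0 := by
    intro i j
    apply dotProduct_eq_zero_of_commute
    have hc := hS.commute i j
    rcases ha i with h | h <;> rcases hb j with h' | h' <;> rw [h, h'] at hc
    · exact hc
    · simpa using hc
    · simpa using hc
    · simpa using hc
  -- Commutation gives one inclusion. The dimensions agree because the independent vectors `a` and
  -- `b` together number as many as the qubits.
  have hspan : Submodule.span (ZMod 2) (Set.range a) =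
      LinearMap.ker (Matrix.mulVecLin (Matrix.of b)) := by
    apply Submodule.eq_of_le_of_finrank_eq
    · rw [Submodule.span_le]
      rintro _ ⟨i, rfl⟩
      ext j
      exact hab i j
    · have h1 := finrank_span_eq_card la
      have h2 : (Matrix.of b).rank = _ := LinearIndependent.rank_matrix (M := Matrix.of b) lb
      have h3 := LinearMap.finrank_range_add_finrank_ker (Matrix.mulVecLin (Matrix.of b))
      have h4 := Fintype.card_subtype_compl (fun i => IsXType (S i))
      have h5 := Fintype.card_subtype_le (fun i => IsXType (S i))
      rw [Matrix.rank] at h2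
      rw [Module.finrank_fintype_fun_eq_card] at h3
      omega
  intro x y hx hy
  -- At a support point, each `Z`-type stabilizer fixes the value of `sgn (b j ⬝ᵥ x)`, so this value
  -- is the same at `x` and `y`.
  have hxy : x - y ∈ Submodule.span (ZMod 2) (Set.range a) := by
    rw [hspan, LinearMap.mem_ker]
    ext j
    change b j ⬝ᵥ (x - y) = 0
    rw [dotProduct_sub, sub_eq_zero]
    apply sgn_injective
    have e := hψ j
    rcases hb j with h | h <;> rw [h] at e
    · have ex := congrFun e x
      have ey := congrFun e y
      rw [pauliZ_mulVec] at ex ey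
      rw [(mul_eq_right₀ hx).1 ex, (mul_eq_right₀ hy).1 ey]
    · have ex := congrFun e x
      have ey := congrFun e y
      rw [Matrix.neg_mulVec, Pi.neg_apply, pauliZ_mulVec, ← neg_mul] at ex ey
      exact neg_injective (((mul_eq_right₀ hx).1 ex).trans ((mul_eq_right₀ hy).1 ey).symm)
  generalize x - y = d at hxy
  induction hxy using Submodule.span_induction with
  | mem d h =>
    obtain ⟨i, rfl⟩ := h
    have e := hψ i
    rcases ha i with h | h <;> rw [h] at e
    · exact ⟨1, Or.inl rfl, fun z => by rw [← pauliX_mulVec (a i) ψ z, e, one_mul]⟩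
    · refine ⟨-1, Or.inr rfl, fun z => ?_⟩
      have ez := congrFun e z
      rw [Matrix.neg_mulVec, Pi.neg_apply, pauliX_mulVec] at ez
      rw [← ez]; ring
  | zero => exact ⟨1, Or.inl rfl, fun z => by simp⟩
  | add d e _ _ hd he =>
    obtain ⟨ε, hε, h⟩ := hd
    obtain ⟨δ, hδ, h'⟩ := he
    exact ⟨δ * ε, sign_mul hδ hε, fun z => by rw [← add_assoc, h', h]; ring⟩
  | smul c d _ hd =>
    rcases zmod_two_cases c with rfl | rfl
    · exact ⟨1, Or.inl rfl, fun z => by simp⟩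
    · simpa using hd

theorem dotProduct_ketbra (w : Ket ι) (ψ : Ket ι) :
    w ⬝ᵥ (ketbra ψ *ᵥ star w) = ((‖w ⬝ᵥ ψ‖ ^ 2 : ℝ) : ℂ) := by
  rw [ketbra, Matrix.vecMulVec_mulVec, dotProduct_smul, Matrix.star_dotProduct_star, op_smul_eq_smul,
    smul_eq_mul, mul_comm, Complex.star_def, Complex.mul_conj, Complex.normSq_eq_norm_sq]

/-- A rank-one operator is extreme up to scale: any pure CSS state with nonzero weight in a
decomposition of `ketbra v` is proportional to `v`. -/
theorem isAffineSign_of_isCSSState_ketbra {v : Ket ι} (h : IsCSSState (ketbra v)) :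
    IsAffineSign v := by
  by_cases hv : v = 0
  · subst hv; intro x y hx; exact absurd rfl hx
  obtain ⟨x₀, hx₀⟩ := Function.ne_iff.1 hv
  obtain ⟨J, _, w, σ, hw, hw1, hσ, hsum⟩ := mem_convexHull_iff_exists_fintype.1 h
  choose ψ hψ hσψ using hσ
  obtain ⟨i, hi⟩ : ∃ i, w i ≠ 0 := by
    by_contra! hc
    simp [hc] at hw1
  -- The expectation of `ketbra v` in such a `u` vanishes and is a sum of nonnegative terms, so each
  -- term vanishes.
  have key : ∀ u : Ket ι, u ⬝ᵥ v = 0 → u ⬝ᵥ ψ i = 0 := by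
    intro u hu
    have h1 : ∑ j, w j * ‖u ⬝ᵥ ψ j‖ ^ 2 = 0 := by
      have h2 := dotProduct_ketbra u v
      rw [← hsum, hu, Matrix.sum_mulVec, dotProduct_sum] at h2
      simp only [hσψ, Matrix.smul_mulVec, dotProduct_smul, dotProduct_ketbra] at h2
      simp only [Complex.real_smul] at h2
      have h3 : ((∑ j, w j * ‖u ⬝ᵥ ψ j‖ ^ 2 : ℝ) : ℂ) = 0 := by simpa using h2
      exact_mod_cast h3
    rw [Finset.sum_eq_zero_iff_of_nonneg fun j _ => mul_nonneg (hw j) (sq_nonneg _)] at h1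
    simpa [hi] using h1 i (Finset.mem_univ i)
  have hprop : ∀ x, v x₀ * ψ i x = v x * ψ i x₀ := by
    intro x
    -- This functional kills `v`; that it also kills `ψ i` is the proportionality at the coordinates
    -- `x` and `x₀`.
    have := key (v x₀ • Pi.single x 1 - v x • Pi.single x₀ 1) (by
      simp [sub_dotProduct, mul_comm])
    simpa [sub_dotProduct, sub_eq_zero] using this
  have hne : ψ i x₀ ≠ 0 := by
    intro h0
    have hz : ∀ x, ψ i x = 0 := fun x => by
      have := hprop x
      rw [h0, mul_zero] at this
      exact (mul_eq_zero.1 this).resolve_left hx₀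
    have := (hψ i).1
    simp [hz] at this
  convert (hψ i).isAffineSign.const_mul (v x₀ / ψ i x₀) using 1
  funext x
  rw [div_mul_eq_mul_div, hprop, mul_div_cancel_right₀ _ hne]

end PureStates

/-! ### Affine unitaries are completely CSS-preserving -/

section AffineUnitary

variable {ι κ : Type} [Fintype ι] [DecidableEq ι] [Fintype κ] [DecidableEq κ]

/-- The unitary `Z(ℓ) X(s) U_A`, where `U_A` permutes the computational basis by the inverse
of the linear map `A`. -/
def affineUnitary (A : (ι → ZMod 2) ≃ₗ[ZMod 2] (ι → ZMod 2)) (s ℓ : ι → ZMod 2) : Op ι :=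
  Matrix.of fun y w => sgn (ℓ ⬝ᵥ y) * if A (y + s) = w then 1 else 0

variable (A : (ι → ZMod 2) ≃ₗ[ZMod 2] (ι → ZMod 2)) (s ℓ : ι → ZMod 2)

theorem affineUnitary_mulVec (ψ : Ket ι) (y : ι → ZMod 2) :
    (affineUnitary A s ℓ *ᵥ ψ) y = sgn (ℓ ⬝ᵥ y) * ψ (A (y + s)) := by
  simp [affineUnitary, Matrix.mulVec, dotProduct]

theorem affineUnitary_mem_unitaryGroup :
    affineUnitary A s ℓ ∈ Matrix.unitaryGroup (ι → ZMod 2) ℂ := by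
  rw [Matrix.mem_unitaryGroup_iff]
  ext x y
  simp only [Matrix.mul_apply, Matrix.star_apply, affineUnitary, Matrix.of_apply, star_mul',
    star_sgn, Matrix.one_apply]
  rw [Finset.sum_eq_single (A (x + s)) (fun b _ hb => by rw [if_neg hb.symm]; ring) (by simp)]
  by_cases h : x = y
  · subst h; simp [sgn_mul_self]
  · have : ¬ y = x := fun h' => h h'.symm
    simp [h, this]

/-- A matrix that conjugates CSS observables to CSS observables. -/
def MapsCSSObservables (W : Op ι) : Prop :=
  ∀ S : Op ι, IsCSSObservable S → IsCSSObservable (W * S * Wᴴ)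

theorem unitary_mul_conjTranspose {W : Op ι} (hW : W ∈ Matrix.unitaryGroup (ι → ZMod 2) ℂ) :
    W * Wᴴ = 1 := Matrix.mem_unitaryGroup_iff.1 hW

theorem unitary_conjTranspose_mul {W : Op ι} (hW : W ∈ Matrix.unitaryGroup (ι → ZMod 2) ℂ) :
    Wᴴ * W = 1 := Matrix.mem_unitaryGroup_iff'.1 hW

theorem unitary_conj_eq_of_mul_eq {W S T : Op ι} (hW : W ∈ Matrix.unitaryGroup (ι → ZMod 2) ℂ)
    (h : W * S = T * W) : W * S * Wᴴ = T := by
  rw [h, Matrix.mul_assoc, unitary_mul_conjTranspose hW, Matrix.mul_one]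

theorem exists_dotProduct_eq (f : (ι → ZMod 2) →ₗ[ZMod 2] ZMod 2) :
    ∃ b : ι → ZMod 2, ∀ x, f x = b ⬝ᵥ x :=
  ⟨fun i => f fun j => if i = j then 1 else 0, fun x => by
    rw [LinearMap.pi_apply_eq_sum_univ f x]
    exact Finset.sum_congr rfl fun i _ => mul_comm _ _⟩

theorem affineUnitary_conj_pauliX (a : ι → ZMod 2) :
    IsXType (affineUnitary A s ℓ * pauliX a * (affineUnitary A s ℓ)ᴴ) := by
  have h : affineUnitary A s ℓ * pauliX a =
      (sgn (ℓ ⬝ᵥ A.symm a) • pauliX (A.symm a)) * affineUnitary A s ℓ :=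
    op_ext_mulVec fun ψ x => by
      simp only [← Matrix.mulVec_mulVec, pauliX_mulVec, affineUnitary_mulVec,
        Matrix.smul_mulVec, Pi.smul_apply, smul_eq_mul, dotProduct_add, sgn_add]
      rw [add_right_comm x, map_add A (x + s), A.apply_symm_apply]
      linear_combination (-sgn (ℓ ⬝ᵥ x) * ψ (A (x + s) + a)) * sgn_mul_self (ℓ ⬝ᵥ A.symm a)
  rw [unitary_conj_eq_of_mul_eq (affineUnitary_mem_unitaryGroup A s ℓ) h]
  refine ⟨A.symm a, ?_⟩
  rcases sgn_eq (ℓ ⬝ᵥ A.symm a) with e | e <;> simp [e]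

theorem affineUnitary_conj_pauliZ (b : ι → ZMod 2) :
    IsZType (affineUnitary A s ℓ * pauliZ b * (affineUnitary A s ℓ)ᴴ) := by
  obtain ⟨b', hb'⟩ := exists_dotProduct_eq
    { toFun := fun x => b ⬝ᵥ A x
      map_add' := fun x y => by rw [map_add, dotProduct_add]
      map_smul' := fun c x => by rw [map_smul, dotProduct_smul]; rfl }
  have h : affineUnitary A s ℓ * pauliZ b =
      (sgn (b' ⬝ᵥ s) • pauliZ b') * affineUnitary A s ℓ :=
    op_ext_mulVec fun ψ x => by
      have e : b ⬝ᵥ A (x + s) = b' ⬝ᵥ x + b' ⬝ᵥ s := by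
        rw [← dotProduct_add, ← hb']; rfl
      simp only [← Matrix.mulVec_mulVec, pauliZ_mulVec, affineUnitary_mulVec,
        Matrix.smul_mulVec, Pi.smul_apply, smul_eq_mul, e, sgn_add]
      ring
  rw [unitary_conj_eq_of_mul_eq (affineUnitary_mem_unitaryGroup A s ℓ) h]
  refine ⟨b', ?_⟩
  rcases sgn_eq (b' ⬝ᵥ s) with e | e <;> simp [e]

theorem affineUnitary_mapsCSSObservables : MapsCSSObservables (affineUnitary A s ℓ) := by
  rintro S (⟨a, rfl | rfl⟩ | ⟨b, rfl | rfl⟩)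
  · exact Or.inl (affineUnitary_conj_pauliX A s ℓ a)
  · obtain ⟨a', h⟩ := affineUnitary_conj_pauliX A s ℓ a
    refine Or.inl ⟨a', ?_⟩
    rcases h with h | h <;> simp [h]
  · exact Or.inr (affineUnitary_conj_pauliZ A s ℓ b)
  · obtain ⟨b', h⟩ := affineUnitary_conj_pauliZ A s ℓ b
    refine Or.inr ⟨b', ?_⟩
    rcases h with h | h <;> simp [h]

/-- Conjugation by a unitary as a homomorphism of monoids. -/
def conjHom (W : Op ι) (hW : W ∈ Matrix.unitaryGroup (ι → ZMod 2) ℂ) : Op ι →* Op ι where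
  toFun M := W * M * Wᴴ
  map_one' := by rw [Matrix.mul_one, unitary_mul_conjTranspose hW]
  map_mul' M N := by
    simp only [Matrix.mul_assoc]
    rw [← Matrix.mul_assoc Wᴴ, unitary_conjTranspose_mul hW, Matrix.one_mul]

theorem conjHom_injective (W : Op ι) (hW : W ∈ Matrix.unitaryGroup (ι → ZMod 2) ℂ) :
    Function.Injective (conjHom W hW) := by
  intro M N h
  have h' := congrArg (fun K => Wᴴ * K * W) h
  have key : ∀ M, Wᴴ * (conjHom W hW M) * W = M := fun M => by
    simp only [conjHom, MonoidHom.coe_mk, OneHom.coe_mk, Matrix.mul_assoc]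
    rw [unitary_conjTranspose_mul hW, Matrix.mul_one, ← Matrix.mul_assoc,
      unitary_conjTranspose_mul hW, Matrix.one_mul]
  simpa only [key] using h'

/-- Conjugation by a unitary is an injective monoid homomorphism fixing `-1`, so membership in the
generated submonoids transfers in both directions. -/
theorem IsCSSGenerators.conj {τ : Type} {S : τ → Op ι} (hS : IsCSSGenerators S) {W : Op ι}
    (hW : W ∈ Matrix.unitaryGroup (ι → ZMod 2) ℂ) (hWS : MapsCSSObservables W) :
    IsCSSGenerators fun i => W * S i * Wᴴ := by
  have hinj := conjHom_injective W hW
  have himg : ∀ T : Set τ, Submonoid.closure ((fun i => W * S i * Wᴴ) '' T) =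
      (Submonoid.closure (S '' T)).map (conjHom W hW) := fun T => by
    rw [MonoidHom.map_mclosure, Set.image_image]; rfl
  refine ⟨fun i => hWS _ (hS.css i), fun i h => hS.ne_one i (hinj (h.trans (map_one _).symm)),
    fun i j => (hS.commute i j).map (conjHom W hW), fun i h => hS.independent i ?_,
    fun h => hS.neg_one_notMem ?_⟩
  · rw [himg] at h
    exact (Submonoid.mem_map_iff_mem hinj).1 h
  · rw [← Set.image_univ, himg] at h
    rw [← Set.image_univ]
    refine (Submonoid.mem_map_iff_mem hinj).1 ?_
    convert h using 1
    simp [conjHom, unitary_mul_conjTranspose hW]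

theorem sum_norm_sq_eq (ψ : Ket ι) : ((∑ x, ‖ψ x‖ ^ 2 : ℝ) : ℂ) = star ψ ⬝ᵥ ψ := by
  rw [Complex.ofReal_sum]
  refine Finset.sum_congr rfl fun x _ => ?_
  rw [← Complex.normSq_eq_norm_sq, ← Complex.mul_conj, mul_comm]
  rfl

theorem IsPureCSSState.conj {ψ : Ket ι} (h : IsPureCSSState ψ) {W : Op ι}
    (hW : W ∈ Matrix.unitaryGroup (ι → ZMod 2) ℂ) (hWS : MapsCSSObservables W) :
    IsPureCSSState (W *ᵥ ψ) := by
  obtain ⟨h1, S, hS, hψ⟩ := h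
  refine ⟨?_, _, hS.conj hW hWS, fun i => ?_⟩
  · rw [← h1]
    apply Complex.ofReal_injective
    rw [sum_norm_sq_eq, sum_norm_sq_eq, Matrix.star_mulVec, ← Matrix.dotProduct_mulVec,
      Matrix.mulVec_mulVec, unitary_conjTranspose_mul hW, Matrix.one_mulVec]
  · rw [Matrix.mulVec_mulVec, Matrix.mul_assoc, unitary_conjTranspose_mul hW, Matrix.mul_one,
      ← Matrix.mulVec_mulVec, hψ]

theorem conjBy_ketbra (W : Op ι) (ψ : Ket ι) : conjBy W (ketbra ψ) = ketbra (W *ᵥ ψ) := by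
  rw [conjBy, ketbra, ketbra, Matrix.mul_vecMulVec, Matrix.vecMulVec_mul, Matrix.star_mulVec]

theorem IsCSSState.conj {ρ : Op ι} (h : IsCSSState ρ) {W : Op ι}
    (hW : W ∈ Matrix.unitaryGroup (ι → ZMod 2) ℂ) (hWS : MapsCSSObservables W) :
    IsCSSState (conjBy W ρ) := by
  let f : Op ι →ₗ[ℝ] Op ι :=
    { toFun := conjBy W
      map_add' := fun M N => by simp [conjBy, Matrix.mul_add, Matrix.add_mul]
      map_smul' := fun c M => by simp [conjBy] }
  have : IsCSSState (f ρ) := by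
    refine convexHull_min (t := f ⁻¹' {σ | IsCSSState σ}) ?_
      ((convex_convexHull ℝ _).linear_preimage f) h
    rintro _ ⟨ψ, hψ, rfl⟩
    exact subset_convexHull ℝ _ ⟨_, hψ.conj hW hWS, conjBy_ketbra W ψ⟩
  exact this

theorem sum_tensor_one_mul (U : Op ι) (x : κ ⊕ ι → ZMod 2) (f : (κ ⊕ ι → ZMod 2) → ℂ) :
    ∑ z, tensor 1 U x z * f z = ∑ b, U (x ∘ Sum.inr) b * f (Sum.elim (x ∘ Sum.inl) b) := by
  rw [← (Equiv.sumArrowEquivProdArrow κ ι (ZMod 2)).symm.sum_comp, Fintype.sum_prod_type,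
    Finset.sum_eq_single (x ∘ Sum.inl)]
  · refine Finset.sum_congr rfl fun b _ => ?_
    change (1 : Op κ) (x ∘ Sum.inl) (x ∘ Sum.inl) * U (x ∘ Sum.inr) b * _ = _
    rw [Matrix.one_apply_eq, one_mul]
    rfl
  · intro a _ ha
    refine Finset.sum_eq_zero fun b _ => ?_
    change (1 : Op κ) (x ∘ Sum.inl) a * U (x ∘ Sum.inr) b * _ = _
    rw [Matrix.one_apply_ne ha.symm, zero_mul, zero_mul]
  · simp

theorem idTensor_conjBy (U : Op ι) (M : Op (κ ⊕ ι)) :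
    idTensor κ (conjBy U) M = conjBy (tensor 1 U) M := by
  ext x y
  have h := sum_tensor_one_mul U y fun z => star ((tensor 1 U * M : Op (κ ⊕ ι)) x z)
  have h' := congrArg star h
  simp only [star_sum, star_mul', star_star] at h'
  simp only [idTensor, conjBy, Matrix.of_apply]
  rw [Matrix.mul_apply, Matrix.mul_apply]
  simp only [Matrix.conjTranspose_apply, mul_comm _ (star _)]
  rw [h']
  refine Finset.sum_congr rfl fun b _ => ?_
  rw [Matrix.mul_apply, Matrix.mul_apply, sum_tensor_one_mul U x fun z => M z _]
  rfl

/-- The identity on one register next to a linear map on another one. -/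
def extendEquiv (κ : Type) (A : (ι → ZMod 2) ≃ₗ[ZMod 2] (ι → ZMod 2)) :
    (κ ⊕ ι → ZMod 2) ≃ₗ[ZMod 2] (κ ⊕ ι → ZMod 2) :=
  (LinearEquiv.sumArrowLequivProdArrow κ ι (ZMod 2) (ZMod 2)).trans
    (((LinearEquiv.refl _ _).prodCongr A).trans
      (LinearEquiv.sumArrowLequivProdArrow κ ι (ZMod 2) (ZMod 2)).symm)

theorem tensor_one_affineUnitary :
    tensor (1 : Op κ) (affineUnitary A s ℓ) =
      affineUnitary (extendEquiv κ A) (Sum.elim (fun _ => 0) s) (Sum.elim (fun _ => 0) ℓ) := by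
  ext x y
  have h1 : Sum.elim (fun _ : κ => 0) ℓ ⬝ᵥ x = ℓ ⬝ᵥ (x ∘ Sum.inr) := by
    simp [dotProduct]
  have h2 : extendEquiv κ A (x + Sum.elim (fun _ => 0) s) = y ↔
      x ∘ Sum.inl = y ∘ Sum.inl ∧ A (x ∘ Sum.inr + s) = y ∘ Sum.inr := by
    have e : extendEquiv κ A (x + Sum.elim (fun _ => 0) s) =
        Sum.elim (x ∘ Sum.inl) (A (x ∘ Sum.inr + s)) := by
      funext i
      rcases i with i | i
      · simp [extendEquiv]
      · rfl
    rw [e]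
    constructor
    · rintro rfl; simp
    · rintro ⟨h, h'⟩; rw [h, h']; exact Sum.elim_comp_inl_inr y
  simp only [tensor, affineUnitary, Matrix.of_apply, Matrix.one_apply, h1, h2, ite_and]
  split_ifs <;> simp

/-- Tensoring with an identity gives another affine unitary on the larger register. It conjugates
CSS observables to CSS observables, hence sends pure CSS states to pure CSS states, and convexity
gives the rest. -/
theorem affineUnitary_preserving : IsCompletelyCSSPreservingUnitary (affineUnitary A s ℓ) := by
  refine ⟨affineUnitary_mem_unitaryGroup A s ℓ, fun m ρ hρ => ?_⟩
  rw [idTensor_conjBy, tensor_one_affineUnitary]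
  exact hρ.conj (affineUnitary_mem_unitaryGroup _ _ _) (affineUnitary_mapsCSSObservables _ _ _)

end AffineUnitary

/-! ### Products of `|+⟩` and `|0⟩`, and their stabilizers -/

section Standard

variable {ι : Type} [Fintype ι] [DecidableEq ι]

/-- `X` (for `t i = true`) or `Z` (for `t i = false`) on the qubit `i`. -/
def standardObservable (t : ι → Bool) (i : ι) : Op ι :=
  if t i then pauliX (Pi.single i 1) else pauliZ (Pi.single i 1)

/-- The `+1` eigenvector of `X` (for `t = true`) or `Z` (for `t = false`) on one qubit. -/
def qubitKet (t : Bool) (a : ZMod 2) : ℂ :=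
  if t then ((√2)⁻¹ : ℝ) else if a = 0 then 1 else 0

/-- The product of the `+1` eigenvectors of `X` or `Z` on each qubit. -/
def standardKet (t : ι → Bool) : Ket ι := fun x => ∏ i, qubitKet (t i) (x i)

theorem sqrt_two_inv_mul_self : (((√2)⁻¹ : ℝ) : ℂ) * (((√2)⁻¹ : ℝ) : ℂ) = 1 / 2 := by
  rw [← Complex.ofReal_mul, ← mul_inv, Real.mul_self_sqrt (by norm_num)]
  norm_num

theorem zmod_two_sum {M : Type*} [AddCommMonoid M] (f : ZMod 2 → M) : ∑ a, f a = f 0 + f 1 :=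
  Fin.sum_univ_two f

theorem qubitKet_sum (t : Bool) : ∑ a, qubitKet t a * qubitKet t a = 1 := by
  rw [zmod_two_sum]
  cases t
  · simp [qubitKet]
  · simp only [qubitKet, if_true, sqrt_two_inv_mul_self]; norm_num

theorem star_qubitKet (t : Bool) (a : ZMod 2) : star (qubitKet t a) = qubitKet t a := by
  unfold qubitKet
  split_ifs <;> simp

theorem pauliZ_apply (b x y : ι → ZMod 2) :
    pauliZ b x y = if x = y then sgn (b ⬝ᵥ x) else 0 := Matrix.diagonal_apply _ _ _

theorem star_standardKet (t : ι → Bool) : star (standardKet t) = standardKet t := by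
  funext x
  simp [standardKet, star_prod, star_qubitKet]

theorem sum_prod_bits (f : ι → ZMod 2 → ℂ) :
    ∑ x : ι → ZMod 2, ∏ i, f i (x i) = ∏ i, ∑ a, f i a := by
  rw [Finset.prod_univ_sum, Fintype.piFinset_univ]

theorem standardKet_dotProduct_self (t : ι → Bool) : standardKet t ⬝ᵥ standardKet t = 1 := by
  simp only [dotProduct, standardKet, ← Finset.prod_mul_distrib]
  rw [sum_prod_bits fun i a => qubitKet (t i) a * qubitKet (t i) a]
  simp [qubitKet_sum]

theorem standardObservable_mulVec (t : ι → Bool) (i : ι) :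
    standardObservable t i *ᵥ standardKet t = standardKet t := by
  funext x
  unfold standardObservable
  split_ifs with h
  · rw [pauliX_mulVec]
    refine Finset.prod_congr rfl fun j _ => ?_
    by_cases hj : j = i
    · subst hj; simp [qubitKet, h]
    · simp [hj]
  · rw [pauliZ_mulVec, single_one_dotProduct]
    rcases zmod_two_cases (x i) with e | e
    · simp [e]
    · have : standardKet t x = 0 :=
        Finset.prod_eq_zero (Finset.mem_univ i) (by simp [qubitKet, h, e])
      simp [this]

theorem pauliZ_mul_pauliX (a b : ι → ZMod 2) :
    pauliZ b * pauliX a = sgn (b ⬝ᵥ a) • (pauliX a * pauliZ b) := by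
  rw [pauliX_mul_pauliZ, smul_smul, sgn_mul_self, one_smul]

theorem standardObservable_css (t : ι → Bool) (i : ι) :
    IsCSSObservable (standardObservable t i) := by
  unfold standardObservable
  split_ifs
  · exact Or.inl ⟨_, Or.inl rfl⟩
  · exact Or.inr ⟨_, Or.inl rfl⟩

theorem standardObservable_commute (t u : ι → Bool) {i j : ι} (h : i = j → t i = u j) :
    Commute (standardObservable t i) (standardObservable u j) := by
  unfold standardObservable
  split_ifs with h1 h2 h2
  · rw [commute_iff_eq, ← pauliX_add, ← pauliX_add, add_comm]
  · have hij : i ≠ j := fun e => by simp_all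
    rw [commute_iff_eq, pauliX_mul_pauliZ]
    simp [hij]
  · have hij : i ≠ j := fun e => by simp_all
    rw [commute_iff_eq, pauliZ_mul_pauliX]
    simp [hij]
  · rw [commute_iff_eq, ← pauliZ_add, ← pauliZ_add, add_comm]

theorem standardObservable_anticommute (t : ι → Bool) (i : ι) :
    standardObservable t i * standardObservable (fun j => !t j) i =
      -(standardObservable (fun j => !t j) i * standardObservable t i) := by
  unfold standardObservable
  rcases h : t i
  · simp [h, pauliX_mul_pauliZ]
  · simp [h, pauliX_mul_pauliZ]

theorem standardKet_ne_zero (t : ι → Bool) : standardKet t ≠ 0 := by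
  intro h
  have := standardKet_dotProduct_self t
  simp [h] at this

theorem standardObservable_not_commute (t : ι → Bool) (i : ι) :
    ¬ Commute (standardObservable t i) (standardObservable (fun j => !t j) i) := by
  intro hc
  have h1 := standardObservable_anticommute t i
  rw [← hc.eq] at h1
  have h2 : standardObservable t i * standardObservable (fun j => !t j) i = 0 := by
    ext x y
    exact self_eq_neg.1 (congrFun (congrFun h1 x) y)
  have h3 := congrArg (fun M => standardObservable t i * M) h2
  simp only [← mul_assoc, (standardObservable_css t i).mul_self, one_mul, mul_zero] at h3
  have h4 := (standardObservable_css (fun j => !t j) i).mul_self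
  rw [h3, mul_zero] at h4
  exact zero_ne_one h4

/-- The opposite Pauli on qubit `g j` commutes with every other generator but not with the one at
`j`, which shows independence. All generators fix the nonzero vector `standardKet t`, which excludes
`-1`. -/
theorem standardObservable_isCSSGenerators {τ : Type} (t : ι → Bool) (g : τ → ι)
    (hg : Function.Injective g) : IsCSSGenerators fun j => standardObservable t (g j) := by
  refine ⟨fun j => standardObservable_css t _, fun j h => ?_, fun i j => ?_, fun j h => ?_,
    fun h => ?_⟩
  · exact standardObservable_not_commute t (g j) (h ▸ Commute.one_left _)
  · exact standardObservable_commute t t fun e => by rw [e]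
  · refine standardObservable_not_commute t (g j) ?_
    have hle : Submonoid.closure ((fun j => standardObservable t (g j)) '' {i | i ≠ j}) ≤
        Submonoid.centralizer {standardObservable (fun j => !t j) (g j)} := by
      rw [Submonoid.closure_le]
      rintro _ ⟨i, hi, rfl⟩
      rw [SetLike.mem_coe, Submonoid.mem_centralizer_iff]
      rintro _ rfl
      exact (standardObservable_commute t _ fun e => absurd (hg e) hi).symm.eq
    exact ((Submonoid.mem_centralizer_iff.1 (hle h)) _ rfl).symm
  · let F : Submonoid (Op ι) :=
      { carrier := {M | M *ᵥ standardKet t = standardKet t}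
        one_mem' := Matrix.one_mulVec _
        mul_mem' := fun {M N} hM hN => by
          change (M * N) *ᵥ _ = _
          rw [← Matrix.mulVec_mulVec, hN, hM] }
    have hle : Submonoid.closure (Set.range fun j => standardObservable t (g j)) ≤ F := by
      rw [Submonoid.closure_le]
      rintro _ ⟨i, rfl⟩
      exact standardObservable_mulVec t _
    have h1 : (-1 : Op ι) *ᵥ standardKet t = standardKet t := hle h
    rw [Matrix.neg_mulVec, Matrix.one_mulVec] at h1
    exact standardKet_ne_zero t (self_eq_neg.1 h1.symm)

theorem standardKet_isPureCSSState (t : ι → Bool) : IsPureCSSState (standardKet t) := by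
  refine ⟨?_, _, standardObservable_isCSSGenerators t id Function.injective_id,
    standardObservable_mulVec t⟩
  apply Complex.ofReal_injective
  rw [sum_norm_sq_eq, star_standardKet, standardKet_dotProduct_self, Complex.ofReal_one]

/-- The tensor product of one-qubit operators. -/
def prodOp : (ι → Matrix (ZMod 2) (ZMod 2) ℂ) →* Op ι where
  toFun M := Matrix.of fun x y => ∏ i, M i (x i) (y i)
  map_one' := by
    ext x y
    simp only [Matrix.of_apply, Pi.one_apply, Matrix.one_apply, Finset.prod_ite_zero]
    simp [funext_iff]
  map_mul' M N := by
    ext x y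
    simp only [Matrix.of_apply, Matrix.mul_apply, Pi.mul_apply, ← Finset.prod_mul_distrib]
    exact (sum_prod_bits fun i a => M i (x i) a * N i a (y i)).symm

theorem prodOp_apply (M : ι → Matrix (ZMod 2) (ZMod 2) ℂ) (x y : ι → ZMod 2) :
    prodOp M x y = ∏ i, M i (x i) (y i) := rfl

theorem posProj_standardObservable (t : ι → Bool) (i : ι) :
    posProj (standardObservable t i) = prodOp (Pi.mulSingle i
      (Matrix.vecMulVec (qubitKet (t i)) (qubitKet (t i)))) := by
  ext x y
  have h1 : prodOp (Pi.mulSingle i (Matrix.vecMulVec (qubitKet (t i)) (qubitKet (t i)))) x y =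
      if ∀ j, ¬ j = i → x j = y j then qubitKet (t i) (x i) * qubitKet (t i) (y i) else 0 := by
    rw [prodOp_apply, ← Finset.mul_prod_erase _ _ (Finset.mem_univ i), Pi.mulSingle_eq_same,
      Matrix.vecMulVec_apply]
    rw [Finset.prod_congr (g := fun j => if x j = y j then (1 : ℂ) else 0) rfl fun j hj => by
      rw [Pi.mulSingle_eq_of_ne (Finset.ne_of_mem_erase hj), Matrix.one_apply]]
    rw [Finset.prod_ite_zero]
    simp
  rw [h1]
  have hxy : x = y ↔ (∀ j, ¬ j = i → x j = y j) ∧ x i = y i := by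
    constructor
    · rintro rfl; simp
    · rintro ⟨h, h'⟩; funext j
      by_cases hj : j = i
      · rw [hj, h']
      · exact h j hj
  have hxy' : x = y + Pi.single i 1 ↔ (∀ j, ¬ j = i → x j = y j) ∧ x i = y i + 1 := by
    constructor
    · rintro rfl; exact ⟨fun j hj => by simp [hj], by simp⟩
    · rintro ⟨h, h'⟩; funext j
      by_cases hj : j = i
      · rw [hj, h']; simp
      · simp [h j hj, hj]
  by_cases hoff : ∀ j, ¬ j = i → x j = y j
  · rw [if_pos hoff]
    rw [and_iff_right hoff] at hxy hxy'
    clear h1 hoff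
    rcases h : t i
    · simp only [posProj, standardObservable, h, pauliZ_apply, Matrix.smul_apply, Matrix.add_apply,
        Matrix.one_apply, hxy, single_one_dotProduct, qubitKet, Bool.false_eq_true, if_false]
      rcases zmod_two_cases (x i) with e | e <;> rcases zmod_two_cases (y i) with e' | e' <;>
        simp [e, e']
      norm_num
    · simp only [posProj, standardObservable, h, pauliX, Matrix.smul_apply, Matrix.add_apply,
        Matrix.one_apply, Matrix.of_apply, hxy, hxy', qubitKet, if_true, sqrt_two_inv_mul_self]
      rcases zmod_two_cases (x i) with e | e <;> rcases zmod_two_cases (y i) with e' | e' <;>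
        simp [e, e', CharTwo.add_self_eq_zero]
  · have n1 : ¬ x = y := fun h => hoff (hxy.1 h).1
    have n2 : ¬ x = y + Pi.single i 1 := fun h => hoff (hxy'.1 h).1
    rw [if_neg hoff]
    cases h : t i <;>
      simp [posProj, standardObservable, h, pauliZ_apply, pauliX, n1, n2]

/-- Because `prodOp` is multiplicative, the product can be computed qubit by qubit; injectivity of
`g` leaves at most one nontrivial factor on each qubit. -/
theorem prod_posProj_standardObservable {m : ℕ} (t : ι → Bool) (g : Fin m → ι)
    (hg : Function.Injective g) :
    (List.ofFn fun j => posProj (standardObservable t (g j))).prod =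
      prodOp fun i => if i ∈ Set.range g then
        Matrix.vecMulVec (qubitKet (t i)) (qubitKet (t i)) else 1 := by
  have h : (fun j => posProj (standardObservable t (g j))) = fun j => prodOp (Pi.mulSingle (g j)
      (Matrix.vecMulVec (qubitKet (t (g j))) (qubitKet (t (g j))))) :=
    funext fun j => posProj_standardObservable t (g j)
  have h' := (List.prod_hom ((List.finRange m).map fun j => Pi.mulSingle (g j)
    (Matrix.vecMulVec (qubitKet (t (g j))) (qubitKet (t (g j)))))
    (prodOp (ι := ι)))
  rw [List.map_map] at h'
  rw [h, List.ofFn_eq_map]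
  refine h'.trans ?_
  congr 1
  funext i
  rw [Pi.list_prod_apply, List.map_map]
  split_ifs with hi
  · obtain ⟨j, rfl⟩ := hi
    rw [List.prod_map_eq_pow_single j]
    · simp [List.count_eq_one_of_mem (List.nodup_finRange m) (List.mem_finRange j)]
    · intro j' hj' _
      exact Pi.mulSingle_eq_of_ne (fun e => hj' (hg e.symm)) _
  · refine List.prod_eq_one fun M hM => ?_
    obtain ⟨j, -, rfl⟩ := List.mem_map.1 hM
    exact Pi.mulSingle_eq_of_ne (fun e => hi ⟨j, e.symm⟩) _

end Standard

/-! ### Completely CSS-preserving unitaries via Bell pairs -/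

theorem IsCompletelyCSSPreservingUnitary.isAffineSignMatrix {n : ℕ} {U : Op (Fin n)}
    (hU : IsCompletelyCSSPreservingUnitary U) : IsAffineSignMatrix U := by
  -- Transversal CNOT on bit strings, an involution. It turns `|+⟩` on the first half and `|0⟩` on
  -- the second into `n` Bell pairs.
  let B : (Fin n ⊕ Fin n → ZMod 2) →ₗ[ZMod 2] (Fin n ⊕ Fin n → ZMod 2) :=
    { toFun := fun x => Sum.elim (x ∘ Sum.inl) (x ∘ Sum.inr + x ∘ Sum.inl)
      map_add' := fun x y => by
        funext i; rcases i with i | i <;> simp [add_add_add_comm]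
      map_smul' := fun c x => by
        funext i; rcases i with i | i <;> simp [mul_add] }
  have hB : Function.Involutive B := fun x => by
    funext i; rcases i with i | i
    · rfl
    · change x (Sum.inr i) + x (Sum.inl i) + x (Sum.inl i) = _
      rw [add_assoc, CharTwo.add_self_eq_zero, add_zero]
  let A := LinearEquiv.ofInvolutive B hB
  let t : Fin n ⊕ Fin n → Bool := Sum.elim (fun _ => true) (fun _ => false)
  have hbell := (standardKet_isPureCSSState t).conj (affineUnitary_mem_unitaryGroup A 0 0)
    (affineUnitary_mapsCSSObservables A 0 0)
  set ψ := affineUnitary A 0 0 *ᵥ standardKet t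
  have hψ : ∀ x y, ψ (Sum.elim x y) = (((√2)⁻¹ : ℝ) : ℂ) ^ n * if y = x then 1 else 0 := by
    intro x y
    change (affineUnitary A 0 0 *ᵥ standardKet t) _ = _
    rw [affineUnitary_mulVec, standardKet, Fintype.prod_sum_type]
    have e1 : ∀ i, A (Sum.elim x y + 0) (Sum.inr i) = y i + x i := fun i => by
      rw [add_zero]; rfl
    simp only [t, qubitKet, e1, Sum.elim_inl, Sum.elim_inr, if_true, Finset.prod_const,
      Finset.card_univ, Fintype.card_fin, zero_dotProduct, sgn_zero, one_mul,
      Bool.false_eq_true, if_false]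
    congr 1
    split_ifs with hyx
    · exact Finset.prod_eq_one fun i _ => by simp [hyx, CharTwo.add_self_eq_zero]
    · obtain ⟨i, hi⟩ := Function.ne_iff.1 hyx
      exact Finset.prod_eq_zero (Finset.mem_univ i) (by simp [CharTwo.add_eq_zero, hi])
  have h := hU.2 n (ketbra ψ) (subset_convexHull ℝ _ ⟨ψ, hbell, rfl⟩)
  rw [idTensor_conjBy, conjBy_ketbra] at h
  have h1 := isAffineSign_of_isCSSState_ketbra h
  -- The reference register carries the column index of `U`, hence the swap. The amplitudes are the
  -- entries of `U` times `(√2)⁻¹ ^ n`, which is divided out below.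
  let f : (Fin n → ZMod 2) × (Fin n → ZMod 2) →+ (Fin n ⊕ Fin n → ZMod 2) :=
    { toFun := fun p => Sum.elim p.2 p.1
      map_zero' := by funext i; rcases i with i | i <;> rfl
      map_add' := fun p q => by funext i; rcases i with i | i <;> rfl }
  have hc : (((√2)⁻¹ : ℝ) : ℂ) ^ n ≠ 0 := by
    apply pow_ne_zero; simp
  unfold IsAffineSignMatrix
  convert (h1.comp f).const_mul ((((√2)⁻¹ : ℝ) : ℂ) ^ n)⁻¹ using 1
  funext ⟨x, y⟩
  rw [eq_inv_mul_iff_mul_eq₀ hc]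
  change _ = ∑ z, tensor 1 U (Sum.elim y x) z * ψ z
  rw [sum_tensor_one_mul]
  simp [hψ, mul_comm]

/-! ### The primitive channels as sums of affine sign Kraus maps -/

section Primitives

variable {ι κ μ : Type} [Fintype ι] [DecidableEq ι] [Fintype κ] [DecidableEq κ]
  [Fintype μ] [DecidableEq μ]

/-- The entries depend only on `x + y`, through a function supported in `{0, a}` that translation by
`a` multiplies by `c`. -/
theorem isAffineSignMatrix_posProj_pauliX {c : ℂ} (hc : c = 1 ∨ c = -1) (a : ι → ZMod 2) :
    IsAffineSignMatrix (posProj (c • pauliX a)) := by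
  let g : (ι → ZMod 2) → ℂ := fun u =>
    1 / 2 * ((if u = 0 then 1 else 0) + c * if u = a then 1 else 0)
  have hg : IsAffineSign g := by
    have h0 : ∀ u, g u ≠ 0 → u = 0 ∨ u = a := by
      intro u hu
      by_contra! h
      simp [g, h] at hu
    have hd : ∀ d, d = 0 ∨ d = a →
        ∃ ε : ℂ, (ε = 1 ∨ ε = -1) ∧ ∀ z, g (z + d) = ε * g z := by
      rintro d (rfl | rfl)
      · exact ⟨1, Or.inl rfl, fun z => by simp⟩
      · refine ⟨c, hc, fun z => ?_⟩
        have hcc : c * c = 1 := by rcases hc with rfl | rfl <;> simp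
        have e : z + d = 0 ↔ z = d := by
          rw [eq_comm, bits_eq_add_iff, zero_add]
        simp only [g, e, add_eq_right]
        linear_combination (-1 / 2 * if z = d then 1 else 0) * hcc
    intro u v hu hv
    apply hd
    rw [bits_sub_eq_add]
    rcases h0 u hu with rfl | rfl <;> rcases h0 v hv with rfl | rfl <;>
      simp [bits_add_self]
  unfold IsAffineSignMatrix
  convert hg.comp (AddMonoidHom.fst (ι → ZMod 2) (ι → ZMod 2) + AddMonoidHom.snd _ _) using 1
  funext ⟨x, y⟩
  have e : ∀ b, x = y + b ↔ x + y = b := fun b => by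
    rw [← sub_eq_iff_eq_add', bits_sub_eq_add]
  have e0 := e 0
  rw [add_zero] at e0
  simp [posProj, pauliX, g, Matrix.one_apply, e, e0]

/-- The matrix is diagonal, and its diagonal is the indicator of the set where `c * sgn (b ⬝ᵥ x) =
1`. -/
theorem isAffineSignMatrix_posProj_pauliZ {c : ℂ} (hc : c = 1 ∨ c = -1) (b : ι → ZMod 2) :
    IsAffineSignMatrix (posProj (c • pauliZ b)) := by
  let f : (ι → ZMod 2) → ℂ := fun x => 1 / 2 * (1 + c * sgn (b ⬝ᵥ x))
  have hf : IsAffineSign f := by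
    intro x y hx hy
    have key : ∀ x, f x ≠ 0 → c * sgn (b ⬝ᵥ x) = 1 := by
      intro x hx
      rcases sign_mul hc (sgn_eq (b ⬝ᵥ x)) with h | h
      · exact h
      · simp [f, h] at hx
    refine ⟨1, Or.inl rfl, fun z => ?_⟩
    have hxy : sgn (b ⬝ᵥ (x - y)) = 1 := by
      have hcc : c * c = 1 := by rcases hc with rfl | rfl <;> simp
      rw [bits_sub_eq_add, dotProduct_add, sgn_add]
      linear_combination (-sgn (b ⬝ᵥ x) * sgn (b ⬝ᵥ y)) * hcc + c * sgn (b ⬝ᵥ x) * key y hy +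
        key x hx
    simp only [f, dotProduct_add, sgn_add, hxy, mul_one, one_mul]
  unfold IsAffineSignMatrix
  convert (isAffineSign_indicator (AddMonoidHom.fst (ι → ZMod 2) (ι → ZMod 2) -
    AddMonoidHom.snd _ _) 0).mul (hf.comp (AddMonoidHom.fst _ _)) using 1
  funext ⟨x, y⟩
  by_cases h : x = y
  · subst h; simp [posProj, pauliZ_apply, f]
  · simp [posProj, pauliZ_apply, h, sub_eq_zero]

theorem IsCSSObservable.exists_eq_smul {S : Op ι} (hS : IsCSSObservable S) :
    ∃ c : ℂ, (c = 1 ∨ c = -1) ∧ ∃ a, S = c • pauliX a ∨ S = c • pauliZ a := by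
  rcases hS with ⟨a, rfl | rfl⟩ | ⟨a, rfl | rfl⟩
  · exact ⟨1, Or.inl rfl, a, Or.inl (by simp)⟩
  · exact ⟨-1, Or.inr rfl, a, Or.inl (by simp)⟩
  · exact ⟨1, Or.inl rfl, a, Or.inr (by simp)⟩
  · exact ⟨-1, Or.inr rfl, a, Or.inr (by simp)⟩

theorem IsCSSObservable.neg {S : Op ι} (hS : IsCSSObservable S) : IsCSSObservable (-S) := by
  rcases hS with ⟨a, rfl | rfl⟩ | ⟨a, rfl | rfl⟩
  · exact Or.inl ⟨a, Or.inr rfl⟩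
  · exact Or.inl ⟨a, Or.inl (neg_neg _)⟩
  · exact Or.inr ⟨a, Or.inr rfl⟩
  · exact Or.inr ⟨a, Or.inl (neg_neg _)⟩

theorem pauliX_conjTranspose (a : ι → ZMod 2) : (pauliX a)ᴴ = pauliX a := by
  ext x y
  simp [pauliX, Matrix.conjTranspose_apply, bits_eq_add_iff (x := x), apply_ite star]

theorem pauliZ_conjTranspose (a : ι → ZMod 2) : (pauliZ a)ᴴ = pauliZ a := by
  rw [pauliZ_eq, Matrix.diagonal_conjTranspose]
  congr 1
  funext x
  simp

theorem IsCSSObservable.conjTranspose {S : Op ι} (hS : IsCSSObservable S) : Sᴴ = S := by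
  rcases hS with ⟨a, rfl | rfl⟩ | ⟨a, rfl | rfl⟩ <;>
    simp [pauliX_conjTranspose, pauliZ_conjTranspose]

theorem posProj_conj_mem {S : Op ι} (hS : IsCSSObservable S) :
    (fun ρ => posProj S * ρ * posProj S) ∈ affineKrausMaps ι ι := by
  have h : (posProj S)ᴴ = posProj S := by
    simp [posProj, Matrix.conjTranspose_smul, hS.conjTranspose]
  have h' : IsAffineSignMatrix (posProj S) := by
    obtain ⟨c, hc, a, rfl | rfl⟩ := hS.exists_eq_smul
    · exact isAffineSignMatrix_posProj_pauliX hc a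
    · exact isAffineSignMatrix_posProj_pauliZ hc a
  convert krausMap_mem h' using 1
  funext ρ
  rw [krausMap, h]

theorem id_mem_affineKrausMaps : (fun ρ => ρ) ∈ affineKrausMaps ι ι := by
  have h : IsAffineSignMatrix (1 : Op ι) := by
    unfold IsAffineSignMatrix
    convert isAffineSign_indicator (AddMonoidHom.fst (ι → ZMod 2) (ι → ZMod 2) -
      AddMonoidHom.snd _ _) 0 using 1
    funext ⟨x, y⟩
    simp [Matrix.one_apply, sub_eq_zero]
  convert krausMap_mem h using 1
  funext ρ
  simp [krausMap]

theorem introduce_ketbra_mem (e : ι ⊕ κ ≃ μ) {ψ : Ket κ} (hψ : IsAffineSign ψ) :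
    (fun ρ : Op ι => relabel e (tensor ρ (ketbra ψ))) ∈ affineKrausMaps ι μ := by
  let K : Matrix (μ → ZMod 2) (ι → ZMod 2) ℂ :=
    Matrix.of fun w x => (if w ∘ e ∘ Sum.inl = x then 1 else 0) * ψ (w ∘ e ∘ Sum.inr)
  have hK : IsAffineSignMatrix K := by
    let f : (μ → ZMod 2) × (ι → ZMod 2) →+ (ι → ZMod 2) :=
      AddMonoidHom.mk' (fun p => p.1 ∘ e ∘ Sum.inl - p.2) fun p q => by
        funext i; simp; ring
    let g : (μ → ZMod 2) × (ι → ZMod 2) →+ (κ → ZMod 2) :=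
      AddMonoidHom.mk' (fun p => p.1 ∘ e ∘ Sum.inr) fun p q => rfl
    unfold IsAffineSignMatrix
    convert (isAffineSign_indicator f 0).mul (hψ.comp g) using 1
    funext p
    simp [K, f, g, sub_eq_zero]
  convert krausMap_mem hK using 1
  funext ρ
  ext x y
  simp only [relabel, tensor, ketbra, Matrix.of_apply, Matrix.vecMulVec_apply, krausMap,
    Matrix.mul_apply, Matrix.conjTranspose_apply, K]
  rw [Finset.sum_eq_single (y ∘ e ∘ Sum.inl), Finset.sum_eq_single (x ∘ e ∘ Sum.inl)]
  · simp only [if_true, one_mul, Function.comp_assoc, Pi.star_apply]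
    ring
  · intro b _ hb
    rw [if_neg hb.symm]; ring
  · simp
  · intro b _ hb
    rw [if_neg hb.symm]; simp
  · simp

/-- The states whose introduction is an allowed map form a convex set, since allowed maps are closed
under sums and nonnegative multiples; so pure states suffice. -/
theorem introduce_mem (e : ι ⊕ κ ≃ μ) {σ : Op κ} (hσ : IsCSSState σ) :
    (fun ρ : Op ι => relabel e (tensor ρ σ)) ∈ affineKrausMaps ι μ := by
  refine convexHull_min
    (t := {σ : Op κ | (fun ρ : Op ι => relabel e (tensor ρ σ)) ∈ affineKrausMaps ι μ}) ?_ ?_ hσ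
  · rintro _ ⟨ψ, hψ, rfl⟩
    exact introduce_ketbra_mem e hψ.isAffineSign
  · intro σ hσ τ hτ a b ha hb _
    change (fun ρ : Op ι => relabel e (tensor ρ (a • σ + b • τ))) ∈ affineKrausMaps ι μ
    convert (affineKrausMaps ι μ).add_mem (smul_mem_affineKrausMaps hσ ha)
      (smul_mem_affineKrausMaps hτ hb) using 1
    funext ρ
    ext x y
    simp [relabel, tensor]
    ring

/-- The Kraus operators are `⟨z|` on the discarded register, one for each basis string `z`; each is
the indicator of an affine subspace. -/
theorem discard_mem (e : ι ⊕ κ ≃ μ) :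
    (fun ρ : Op μ => partialTrace (relabel e.symm ρ)) ∈ affineKrausMaps μ ι := by
  let K : (κ → ZMod 2) → Matrix (ι → ZMod 2) (μ → ZMod 2) ℂ := fun z =>
    Matrix.of fun x w => if Sum.elim x z ∘ e.symm = w then 1 else 0
  have hK : ∀ z, IsAffineSignMatrix (K z) := by
    intro z
    let f : (ι → ZMod 2) × (μ → ZMod 2) →+ (μ → ZMod 2) :=
      AddMonoidHom.mk' (fun p => p.2 - Sum.elim p.1 (fun _ => 0) ∘ e.symm) fun p q => by
        funext i
        obtain ⟨j, rfl⟩ := e.surjective i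
        rcases j with j | j <;> simp
        ring
    unfold IsAffineSignMatrix
    convert isAffineSign_indicator f (Sum.elim (fun _ => 0) z ∘ e.symm) using 1
    funext p
    have : Sum.elim p.1 z ∘ e.symm = p.2 ↔ f p = Sum.elim (fun _ => 0) z ∘ e.symm := by
      have h : Sum.elim p.1 z ∘ e.symm =
          Sum.elim (fun _ => 0) z ∘ e.symm + Sum.elim p.1 (fun _ => 0) ∘ e.symm := by
        funext i
        obtain ⟨j, rfl⟩ := e.surjective i
        rcases j with j | j <;> simp
      change _ ↔ p.2 - _ = _
      rw [sub_eq_iff_eq_add, h, eq_comm]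
    simp [K, this]
  convert (affineKrausMaps μ ι).sum_mem (t := Finset.univ) fun z _ => krausMap_mem (hK z) using 1
  funext ρ
  ext x y
  rw [Finset.sum_apply, Matrix.sum_apply]
  refine Finset.sum_congr rfl fun z _ => ?_
  simp [relabel, krausMap, Matrix.mul_apply, K, apply_ite star]

end Primitives

/-! ### Sequences and circuits -/

theorem IsCSSSequence.mem_affineKrausMaps {n k : ℕ} {E : Op (Fin n) → Op (Fin k)}
    (hE : IsCSSSequence E) : E ∈ affineKrausMaps (Fin n) (Fin k) := by
  induction hE with
  | done => exact id_mem_affineKrausMaps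
  | introduce σ hσ E _ ih => exact comp_mem_affineKrausMaps ih (introduce_mem _ hσ)
  | gate U hU E _ ih =>
    exact comp_mem_affineKrausMaps ih (krausMap_mem hU.isAffineSignMatrix)
  | measure S hS E₁ E₂ _ _ ih₁ ih₂ =>
    exact (affineKrausMaps _ _).add_mem (comp_mem_affineKrausMaps ih₁ (posProj_conj_mem hS))
      (comp_mem_affineKrausMaps ih₂ (posProj_conj_mem hS.neg))
  | discard e E _ ih => exact comp_mem_affineKrausMaps ih (discard_mem e)

theorem IsCSSCircuit.mem_affineKrausMaps {n k : ℕ} {E : Op (Fin n) → Op (Fin k)}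
    (hE : IsCSSCircuit E) : E ∈ affineKrausMaps (Fin n) (Fin k) := by
  obtain ⟨r, q, F, hq, -, hF, h⟩ := hE
  have : E = ∑ i, q i • F i := by
    funext ρ
    rw [h, Finset.sum_apply]
    rfl
  rw [this]
  exact (affineKrausMaps _ _).sum_mem fun i _ =>
    smul_mem_affineKrausMaps (hF i).mem_affineKrausMaps (hq i)

/-! ### Normal forms of linear relations and of affine sign functions -/

section LinearRelations

/-- A linear relation is, up to automorphisms, an identity next to a product of full and zero
subspaces. -/
theorem exists_linear_relation_normal_form {K V W : Type*} [Field K] [AddCommGroup V] [Module K V]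
    [AddCommGroup W] [Module K W] (L : Submodule K (V × W)) :
    ∃ (C N D : Submodule K V) (M R : Submodule K W) (eV : V ≃ₗ[K] C × N × D)
      (eW : W ≃ₗ[K] C × M × R), ∀ x y, (x, y) ∈ L ↔
        (eV x).1 = (eW y).1 ∧ (eV x).2.2 = 0 ∧ (eW y).2.2 = 0 := by
  set dom := L.map (LinearMap.fst K V W) with hdom
  set rng := L.map (LinearMap.snd K V W) with hrng
  set N := L.comap (LinearMap.inl K V W) with hN
  set M := L.comap (LinearMap.inr K V W) with hM
  have hNdom : N ≤ dom := fun x hx => ⟨(x, 0), hx, rfl⟩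
  obtain ⟨C₀, hC₀⟩ := N.exists_isCompl
  obtain ⟨D, hD⟩ := dom.exists_isCompl
  obtain ⟨R, hR⟩ := rng.exists_isCompl
  -- By the modular law this is a complement of `N` inside `dom`.
  set C := C₀ ⊓ dom
  have hCN : N ⊔ C = dom := by
    rw [← sup_inf_assoc_of_le C₀ hNdom, hC₀.sup_eq_top, top_inf_eq]
  have hCN0 : ∀ x, x ∈ C → x ∈ N → x = 0 := fun x hx hx' =>
    Submodule.disjoint_def.1 hC₀.disjoint x hx' hx.1
  have hD0 : ∀ x, x ∈ dom → x ∈ D → x = 0 := Submodule.disjoint_def.1 hD.disjoint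
  have hR0 : ∀ x, x ∈ rng → x ∈ R → x = 0 := Submodule.disjoint_def.1 hR.disjoint
  -- The projection of `L` onto `dom` splits linearly; `g` chooses a partner for each element of
  -- `C`, so the graph of `g` is the part of `L` that becomes the identity.
  obtain ⟨g, hg⟩ : ∃ g : C →ₗ[K] W, ∀ c : C, ((c : V), g c) ∈ L := by
    let f : L →ₗ[K] dom := (LinearMap.fst K V W).submoduleMap L
    obtain ⟨σ, hσ⟩ := f.exists_rightInverse_of_surjective
      (LinearMap.range_eq_top.2 ((LinearMap.fst K V W).submoduleMap_surjective L))
    refine ⟨LinearMap.snd K V W ∘ₗ L.subtype ∘ₗ σ ∘ₗ Submodule.inclusion inf_le_right,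
      fun c => ?_⟩
    have h := congrArg Subtype.val
      (LinearMap.congr_fun hσ (Submodule.inclusion (inf_le_right : C ≤ dom) c))
    have h' : ((σ (Submodule.inclusion (inf_le_right : C ≤ dom) c)) : V × W).1 = c := h
    have := (σ (Submodule.inclusion (inf_le_right : C ≤ dom) c)).2
    rw [← h']
    exact this
  have memN : ∀ x : V, (x, (0 : W)) ∈ L ↔ x ∈ N := fun x => Iff.rfl
  have memM : ∀ y : W, ((0 : V), y) ∈ L ↔ y ∈ M := fun x => Iff.rfl
  let φV : C × N × D →ₗ[K] V := C.subtype.coprod (N.subtype.coprod D.subtype)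
  let φW : C × M × R →ₗ[K] W := g.coprod (M.subtype.coprod R.subtype)
  have key : ∀ p q, (φV p, φW q) ∈ L ↔ p.1 = q.1 ∧ p.2.2 = 0 ∧ q.2.2 = 0 := by
    rintro ⟨c, n, d⟩ ⟨c', m, r⟩
    change ((c : V) + ((n : V) + d), g c' + ((m : W) + r)) ∈ L ↔ c = c' ∧ d = 0 ∧ r = 0
    have hcn : ((c : V), g c) + ((n : V), 0) + (0, (m : W)) ∈ L :=
      L.add_mem (L.add_mem (hg c) n.2) m.2
    constructor
    · intro h
      have hd : d = 0 := by
        refine Subtype.ext (hD0 d ?_ d.2)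
        have h1 := dom.sub_mem (⟨_, h, rfl⟩ : _ ∈ dom) (⟨_, hcn, rfl⟩ : _ ∈ dom)
        simpa using h1
      have hcn' : ((c' : V), g c') + ((n : V), 0) + (0, (m : W)) ∈ L :=
        L.add_mem (L.add_mem (hg c') n.2) m.2
      have hr : r = 0 := by
        refine Subtype.ext (hR0 r ?_ r.2)
        have h1 := rng.sub_mem (⟨_, h, rfl⟩ : _ ∈ rng) (⟨_, hcn', rfl⟩ : _ ∈ rng)
        have e : g c' + ((m : W) + r) - (g c' + 0 + m) = r := by abel
        change g c' + ((m : W) + r) - (g c' + 0 + m) ∈ rng at h1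
        rwa [e] at h1
      subst hd hr
      refine ⟨Subtype.ext (sub_eq_zero.1 (hCN0 _ (C.sub_mem c.2 c'.2) ?_)), rfl, rfl⟩
      rw [← memN]
      have h1 := L.sub_mem h hcn'
      simpa using h1
    · rintro ⟨rfl, rfl, rfl⟩
      simpa using hcn
  have hV : Function.Bijective φV := by
    constructor
    · rw [← LinearMap.ker_eq_bot, LinearMap.ker_eq_bot']
      rintro ⟨c, n, d⟩ h
      -- The zero pair lies in `L`, so `key` already forces the `C` and `D` components to vanish.
      have h0 : (φV (c, n, d), φW 0) ∈ L := by rw [h, map_zero]; exact L.zero_mem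
      obtain ⟨h1, h2, -⟩ := (key _ _).1 h0
      change c = 0 at h1
      change d = 0 at h2
      subst h1 h2
      have h3 : (n : V) = 0 := by simpa [φV] using h
      simp [Submodule.coe_eq_zero.1 h3]
    · intro x
      obtain ⟨y, hy, d, hd, rfl⟩ :=
        Submodule.mem_sup.1 (hD.sup_eq_top ▸ Submodule.mem_top : x ∈ dom ⊔ D)
      rw [← hCN] at hy
      obtain ⟨n, hn, c, hc, rfl⟩ := Submodule.mem_sup.1 hy
      refine ⟨(⟨c, hc⟩, ⟨n, hn⟩, ⟨d, hd⟩), ?_⟩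
      change c + (n + d) = n + c + d
      abel
  have hW : Function.Bijective φW := by
    constructor
    · rw [← LinearMap.ker_eq_bot, LinearMap.ker_eq_bot']
      rintro ⟨c, m, r⟩ h
      have h0 : (φV 0, φW (c, m, r)) ∈ L := by rw [h, map_zero]; exact L.zero_mem
      obtain ⟨h1, -, h2⟩ := (key _ _).1 h0
      change 0 = c at h1
      change r = 0 at h2
      subst h1 h2
      have h3 : (m : W) = 0 := by simpa [φW] using h
      simp [Submodule.coe_eq_zero.1 h3]
    · intro y
      obtain ⟨w, ⟨⟨x, w'⟩, hw, e⟩, r, hr, rfl⟩ :=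
        Submodule.mem_sup.1 (hR.sup_eq_top ▸ Submodule.mem_top : y ∈ rng ⊔ R)
      change w' = w at e
      subst e
      have hx : x ∈ N ⊔ C := hCN ▸ ⟨_, hw, rfl⟩
      obtain ⟨n, hn, c, hc, rfl⟩ := Submodule.mem_sup.1 hx
      have hm : w' - g ⟨c, hc⟩ ∈ M := by
        rw [← memM]
        have := L.sub_mem (L.sub_mem hw (hg ⟨c, hc⟩)) hn
        simpa using this
      refine ⟨(⟨c, hc⟩, ⟨_, hm⟩, ⟨r, hr⟩), ?_⟩
      change g ⟨c, hc⟩ + (w' - g ⟨c, hc⟩ + r) = w' + r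
      abel
  refine ⟨C, N, D, M, R, (LinearEquiv.ofBijective φV hV).symm,
    (LinearEquiv.ofBijective φW hW).symm, fun x y => ?_⟩
  have h := key ((LinearEquiv.ofBijective φV hV).symm x) ((LinearEquiv.ofBijective φW hW).symm y)
  have ex := (LinearEquiv.ofBijective φV hV).apply_symm_apply x
  have ey := (LinearEquiv.ofBijective φW hW).apply_symm_apply y
  rw [LinearEquiv.ofBijective_apply] at ex ey
  rwa [ex, ey] at h

/-- Coordinates adapted to a decomposition into three summands. -/
theorem exists_adapted_coordinates {n r : ℕ} {C N D : Type*} [AddCommGroup C] [Module (ZMod 2) C]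
    [AddCommGroup N] [Module (ZMod 2) N] [AddCommGroup D] [Module (ZMod 2) D]
    (e : (Fin n → ZMod 2) ≃ₗ[ZMod 2] C × N × D) (b : C ≃ₗ[ZMod 2] (Fin r → ZMod 2)) :
    ∃ (hr : r ≤ n) (A : (Fin n → ZMod 2) ≃ₗ[ZMod 2] (Fin n → ZMod 2)) (t : Fin (n - r) → Bool),
      ∀ x, A x ∘ split hr ∘ Sum.inl = b (e x).1 ∧
        ((∀ i, t i = false → A x (split hr (Sum.inr i)) = 0) ↔ (e x).2.2 = 0) := by
  have : Module.Finite (ZMod 2) (C × N × D) := Module.Finite.equiv e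
  have : Module.Finite (ZMod 2) N := Module.Finite.of_surjective
    (LinearMap.fst (ZMod 2) N D ∘ₗ LinearMap.snd (ZMod 2) C (N × D))
    fun x => ⟨(0, x, 0), rfl⟩
  have : Module.Finite (ZMod 2) D := Module.Finite.of_surjective
    (LinearMap.snd (ZMod 2) N D ∘ₗ LinearMap.snd (ZMod 2) C (N × D))
    fun x => ⟨(0, 0, x), rfl⟩
  have : Module.Finite (ZMod 2) C := Module.Finite.equiv b.symm
  have hn : n = r + (Module.finrank (ZMod 2) N + Module.finrank (ZMod 2) D) := by
    have h := e.finrank_eq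
    have h' := b.finrank_eq
    simp only [Module.finrank_prod, Module.finrank_fin_fun] at h h'
    rw [h, h']
  let bN := (Module.finBasis (ZMod 2) N).equivFun
  let bD := (Module.finBasis (ZMod 2) D).equivFun
  have hr : r ≤ n := by omega
  let σ : Fin (Module.finrank (ZMod 2) N) ⊕ Fin (Module.finrank (ZMod 2) D) ≃ Fin (n - r) :=
    finSumFinEquiv.trans (finCongr (by omega))
  let τ : Fin n ≃ Fin r ⊕ (Fin (Module.finrank (ZMod 2) N) ⊕ Fin (Module.finrank (ZMod 2) D)) :=
    (split hr).symm.trans (Equiv.sumCongr (Equiv.refl _) σ.symm)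
  let A : (Fin n → ZMod 2) ≃ₗ[ZMod 2] (Fin n → ZMod 2) :=
    e.trans ((b.prodCongr ((bN.prodCongr bD).trans
      (LinearEquiv.sumArrowLequivProdArrow _ _ (ZMod 2) (ZMod 2)).symm)).trans
      ((LinearEquiv.sumArrowLequivProdArrow _ _ (ZMod 2) (ZMod 2)).symm.trans
        (LinearEquiv.funCongrLeft (ZMod 2) (ZMod 2) τ)))
  have hA : ∀ x i, A x i =
      Sum.elim (b (e x).1) (Sum.elim (bN (e x).2.1) (bD (e x).2.2)) (τ i) := fun x i => rfl
  -- The mask is `true` (`X`, a free coordinate) on the `N` part and `false` (`Z`, a coordinate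
  -- forced to zero) on the `D` part.
  refine ⟨hr, A, fun i => (σ.symm i).isLeft, fun x => ⟨?_, ?_⟩⟩
  · funext i
    simp [hA, τ]
  · constructor
    · intro h
      apply bD.injective
      rw [map_zero]
      funext i
      have := h (σ (Sum.inr i)) (by simp)
      simpa [hA, τ] using this
    · intro h i hi
      obtain ⟨j, rfl⟩ := σ.surjective i
      rcases j with j | j
      · simp at hi
      · simp [hA, τ, h]

end LinearRelations

/-- An affine sign function is a multiple of a sign character on an affine subspace. -/
theorem IsAffineSign.exists_eq {G : Type*} [AddCommGroup G] [Module (ZMod 2) G] {f : G → ℂ}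
    (hf : IsAffineSign f) : ∃ (c : ℂ) (s : G) (L : Submodule (ZMod 2) G) (ℓ : G →ₗ[ZMod 2] ZMod 2),
      (∀ x, x - s ∈ L → f x = c * sgn (ℓ x)) ∧ ∀ x, x - s ∉ L → f x = 0 := by
  by_cases h0 : ∀ x, f x = 0
  · exact ⟨0, 0, ⊥, 0, fun x _ => by simp [h0], fun x _ => h0 x⟩
  push Not at h0
  obtain ⟨s, hs⟩ := h0
  -- Translations paired with the sign they produce. A linear section over the first projection
  -- turns the sign into a linear functional, which is then extended to `G`.
  let Γ : Submodule (ZMod 2) (G × ZMod 2) :=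
    { carrier := {p | ∀ z, f (z + p.1) = sgn p.2 * f z}
      zero_mem' := fun z => by simp
      add_mem' := fun {p q} hp hq z => by
        simp only [Prod.fst_add, Prod.snd_add, ← add_assoc, sgn_add]
        rw [hq, hp]; ring
      smul_mem' := fun c p hp => by
        rcases zmod_two_cases c with rfl | rfl
        · intro z; simp
        · simpa using hp }
  let π := (LinearMap.fst (ZMod 2) G (ZMod 2)).submoduleMap Γ
  obtain ⟨σ, hσ⟩ := π.exists_rightInverse_of_surjective
    (LinearMap.range_eq_top.2 ((LinearMap.fst (ZMod 2) G (ZMod 2)).submoduleMap_surjective Γ))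
  obtain ⟨ℓ, hℓ⟩ := LinearMap.exists_extend
    (LinearMap.snd (ZMod 2) G (ZMod 2) ∘ₗ Γ.subtype ∘ₗ σ)
  -- The law based at `s` gives the sign `sgn (ℓ (x - s))`; the factor `sgn (ℓ s)` compensates for
  -- writing `sgn (ℓ x)` instead.
  refine ⟨sgn (ℓ s) * f s, s, Γ.map (LinearMap.fst (ZMod 2) G (ZMod 2)), ℓ, fun x hx => ?_,
    fun x hx => ?_⟩
  · have h1 : ((σ ⟨x - s, hx⟩ : Γ) : G × ZMod 2).1 = x - s :=
      congrArg Subtype.val (LinearMap.congr_fun hσ ⟨x - s, hx⟩)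
    have h2 : ℓ (x - s) = ((σ ⟨x - s, hx⟩ : Γ) : G × ZMod 2).2 :=
      LinearMap.congr_fun hℓ ⟨x - s, hx⟩
    have h3 := (σ ⟨x - s, hx⟩).2 s
    rw [h1, ← h2, add_sub_cancel, map_sub, CharTwo.sub_eq_add, sgn_add] at h3
    rw [h3]; ring
  · by_contra hfx
    obtain ⟨ε, hε, h⟩ := hf x s hfx hs
    refine hx ?_
    rcases hε with rfl | rfl
    · exact ⟨(x - s, 0), fun z => by simpa using h z, rfl⟩
    · exact ⟨(x - s, 1), fun z => by simpa using h z, rfl⟩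

/-- Ensures that a code generator has only one type, so the two encoding conditions never compete.
-/
theorem eq_one_or_neg_one_of_isXType_of_isZType {ι : Type} [Fintype ι] [DecidableEq ι] {S : Op ι}
    (hX : IsXType S) (hZ : IsZType S) : S = 1 ∨ S = -1 := by
  obtain ⟨a, ha⟩ := hX
  obtain ⟨b, hb⟩ := hZ
  have h1 : S a 0 ≠ 0 := by
    rcases ha with rfl | rfl <;> simp [pauliX]
  have h2 : a = 0 := by
    by_contra h
    apply h1
    rcases hb with rfl | rfl <;> simp [pauliZ_apply, h]
  subst h2
  rwa [pauliX_zero] at ha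

/-! ### Standard Kraus operators as code projections -/

section Decoding

variable {n r : ℕ} (hr : r ≤ n) (t : Fin (n - r) → Bool)

/-- The projector onto the standard state with mask `t` on the last `n - r` qubits. -/
def standardProjector : Op (Fin n) :=
  Matrix.of fun x y => if x ∘ split hr ∘ Sum.inl = y ∘ split hr ∘ Sum.inl then
    standardKet t (x ∘ split hr ∘ Sum.inr) * standardKet t (y ∘ split hr ∘ Sum.inr) else 0

/-- The mask `t` on the last `n - r` qubits, extended arbitrarily to all qubits. -/
def extendMask (i : Fin n) : Bool := Sum.elim (fun _ => false) t ((split hr).symm i)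

theorem prod_posProj_eq_standardProjector :
    (List.ofFn fun j => posProj (standardObservable (extendMask hr t)
      (split hr (Sum.inr j)))).prod = standardProjector hr t := by
  rw [prod_posProj_standardObservable (extendMask hr t) (fun j => split hr (Sum.inr j))
    ((split hr).injective.comp Sum.inr_injective)]
  ext x y
  rw [prodOp_apply, ← (split hr).prod_comp, Fintype.prod_sum_type]
  have h1 : ∀ i, ¬ split hr (Sum.inl i) ∈ Set.range fun j => split hr (Sum.inr j) := by
    rintro i ⟨j, h⟩
    simpa using (split hr).injective h
  have h2 : ∀ i, split hr (Sum.inr i) ∈ Set.range fun j => split hr (Sum.inr j) :=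
    fun i => ⟨i, rfl⟩
  simp only [h1, h2, if_true, if_false, extendMask, Equiv.symm_apply_apply, Sum.elim_inr,
    Matrix.vecMulVec_apply, Matrix.one_apply, Finset.prod_mul_distrib]
  rw [standardProjector, Matrix.of_apply, Finset.prod_ite_zero]
  have h3 : (∀ i ∈ Finset.univ, x (split hr (Sum.inl i)) = y (split hr (Sum.inl i))) ↔
      x ∘ split hr ∘ Sum.inl = y ∘ split hr ∘ Sum.inl := by
    simp [funext_iff]
  simp only [h3, ite_mul, zero_mul, Finset.prod_const_one, one_mul]
  rfl

variable {k : ℕ} (hk : r ≤ k) (u : Fin (k - r) → Bool)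

/-- The identity on the first `r` qubits, tensored with the projection of the other input qubits
onto the standard state with mask `t` and the preparation of the standard state with mask `u`. -/
def standardKraus : Matrix (Fin k → ZMod 2) (Fin n → ZMod 2) ℂ :=
  Matrix.of fun w x => if w ∘ split hk ∘ Sum.inl = x ∘ split hr ∘ Sum.inl then
    standardKet u (w ∘ split hk ∘ Sum.inr) * standardKet t (x ∘ split hr ∘ Sum.inr) else 0

/-- Both sides factor through the compression `T` of `σ` to the first `r` qubits by the standard bra
on the others. On the right, the partial trace contributes only the squared norm of the standard
state, which is one. -/
theorem krausMap_standardKraus (σ : Op (Fin n)) :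
    krausMap (standardKraus hr t hk u) σ = relabel (split hk)
      (tensor (partialTrace (relabel (split hr).symm
        (standardProjector hr t * σ * standardProjector hr t))) (ketbra (standardKet u))) := by
  have hstar : ∀ {m : ℕ} (v : Fin m → Bool) z, star (standardKet v z) = standardKet v z :=
    fun v z => congrFun (star_standardKet v) z
  let J : (Fin r → ZMod 2) → (Fin n → ZMod 2) → ℂ := fun a x =>
    if a = x ∘ split hr ∘ Sum.inl then standardKet t (x ∘ split hr ∘ Sum.inr) else 0
  let T : (Fin r → ZMod 2) → (Fin r → ZMod 2) → ℂ := fun a b =>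
    ∑ y, (∑ x, J a x * σ x y) * J b y
  have hK : ∀ w x, standardKraus hr t hk u w x =
      standardKet u (w ∘ split hk ∘ Sum.inr) * J (w ∘ split hk ∘ Sum.inl) x := by
    intro w x
    simp only [standardKraus, Matrix.of_apply, J, mul_ite, mul_zero]
  have hJ : ∀ a x, star (J a x) = J a x := by
    intro a x
    simp only [J]
    split_ifs
    · exact hstar _ _
    · simp
  have hQ : ∀ x y, standardProjector hr t x y =
      standardKet t (x ∘ split hr ∘ Sum.inr) * J (x ∘ split hr ∘ Sum.inl) y := by
    intro x y
    simp only [standardProjector, Matrix.of_apply, J, mul_ite, mul_zero]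
  have hQ' : ∀ x y, standardProjector hr t x y =
      J (y ∘ split hr ∘ Sum.inl) x * standardKet t (y ∘ split hr ∘ Sum.inr) := by
    intro x y
    simp only [standardProjector, Matrix.of_apply, J, ite_mul, zero_mul]
    simp only [eq_comm]
  ext w w'
  have hL : krausMap (standardKraus hr t hk u) σ w w' =
      standardKet u (w ∘ split hk ∘ Sum.inr) * standardKet u (w' ∘ split hk ∘ Sum.inr) *
        T (w ∘ split hk ∘ Sum.inl) (w' ∘ split hk ∘ Sum.inl) := by
    simp only [krausMap, Matrix.mul_apply, Matrix.conjTranspose_apply, hK, star_mul', hJ, hstar, T,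
      Finset.mul_sum, Finset.sum_mul]
    refine Finset.sum_congr rfl fun y _ => Finset.sum_congr rfl fun x _ => ?_
    ring
  have hR : ∀ x y, (standardProjector hr t * σ * standardProjector hr t) x y =
      standardKet t (x ∘ split hr ∘ Sum.inr) * standardKet t (y ∘ split hr ∘ Sum.inr) *
        T (x ∘ split hr ∘ Sum.inl) (y ∘ split hr ∘ Sum.inl) := by
    intro x y
    rw [Matrix.mul_apply]
    simp only [Matrix.mul_apply (M := standardProjector hr t), hQ x, hQ' _ y, T,
      Finset.mul_sum, Finset.sum_mul]
    refine Finset.sum_congr rfl fun y _ => Finset.sum_congr rfl fun x _ => ?_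
    ring
  rw [hL]
  simp only [relabel, tensor, partialTrace, Matrix.of_apply, hR, ketbra, Matrix.vecMulVec_apply,
    Pi.star_apply, hstar]
  have e1 : ∀ (a : Fin r → ZMod 2) (z : Fin (n - r) → ZMod 2),
      (Sum.elim a z ∘ (split hr).symm) ∘ split hr ∘ Sum.inl = a := fun a z => by
    funext i; simp
  have e2 : ∀ (a : Fin r → ZMod 2) (z : Fin (n - r) → ZMod 2),
      (Sum.elim a z ∘ (split hr).symm) ∘ split hr ∘ Sum.inr = z := fun a z => by
    funext i; simp
  simp only [e1, e2, ← Finset.sum_mul]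
  have h1 : ∑ z, standardKet t z * standardKet t z = 1 := standardKet_dotProduct_self t
  rw [h1, one_mul, mul_comm]
  rfl

/-- The code whose generators are obtained from `X` or `Z` on the last `n - r` qubits by an affine
unitary. -/
def affineCode (hrn : r < n) (A : (Fin n → ZMod 2) ≃ₗ[ZMod 2] (Fin n → ZMod 2))
    (s ℓ : Fin n → ZMod 2) : CSSCode n r where
  lt := hrn
  gen i := affineUnitary A s ℓ * standardObservable (extendMask hr t) (split hr (Sum.inr i)) *
    (affineUnitary A s ℓ)ᴴ
  isGen := (standardObservable_isCSSGenerators (extendMask hr t) (fun i => split hr (Sum.inr i))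
    ((split hr).injective.comp Sum.inr_injective)).conj (affineUnitary_mem_unitaryGroup A s ℓ)
      (affineUnitary_mapsCSSObservables A s ℓ)

variable (hrn : r < n) (A : (Fin n → ZMod 2) ≃ₗ[ZMod 2] (Fin n → ZMod 2)) (s ℓ : Fin n → ZMod 2)

theorem conjTranspose_conj_conj {ι : Type} [Fintype ι] [DecidableEq ι] {V : Op ι}
    (hV : V ∈ Matrix.unitaryGroup (ι → ZMod 2) ℂ) (S : Op ι) : Vᴴ * (V * S * Vᴴ) * V = S := by
  rw [← Matrix.mul_assoc, ← Matrix.mul_assoc, unitary_conjTranspose_mul hV, Matrix.one_mul,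
    Matrix.mul_assoc, unitary_conjTranspose_mul hV, Matrix.mul_one]

/-- Decoding undoes the conjugation that defines the generators. Affine unitaries preserve the type
of an observable, so the type of a generator reveals whether it came from `X` or `Z`. -/
theorem affineCode_isEncodingUnitary :
    (affineCode hr t hrn A s ℓ).IsEncodingUnitary (affineUnitary A s ℓ) := by
  have hnot : ∀ i, IsXType ((affineCode hr t hrn A s ℓ).gen i) →
      ¬ IsZType ((affineCode hr t hrn A s ℓ).gen i) := by
    intro i hX hZ
    have hG := (affineCode hr t hrn A s ℓ).isGen
    rcases eq_one_or_neg_one_of_isXType_of_isZType hX hZ with h | h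
    · exact hG.ne_one i h
    · exact hG.neg_one_notMem (h ▸ Submonoid.subset_closure ⟨i, rfl⟩)
  have hgen : ∀ i, (affineUnitary A s ℓ)ᴴ * (affineCode hr t hrn A s ℓ).gen i *
      affineUnitary A s ℓ = standardObservable (extendMask hr t) (split hr (Sum.inr i)) :=
    fun i => conjTranspose_conj_conj (affineUnitary_mem_unitaryGroup A s ℓ) _
  refine ⟨affineUnitary_preserving A s ℓ, fun i hi => ?_, fun i hi => ?_⟩
  · rw [hgen, standardObservable, if_neg]
    intro ht
    refine hnot i ?_ hi
    simp only [affineCode, standardObservable, if_pos ht]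
    exact affineUnitary_conj_pauliX A s ℓ _
  · rw [hgen, standardObservable, if_pos]
    by_contra ht
    refine hnot i hi ?_
    simp only [affineCode, standardObservable, if_neg ht]
    exact affineUnitary_conj_pauliZ A s ℓ _

theorem affineCode_projector : (affineCode hr t hrn A s ℓ).projector =
    affineUnitary A s ℓ * standardProjector hr t * (affineUnitary A s ℓ)ᴴ := by
  have hV := affineUnitary_mem_unitaryGroup A s ℓ
  have h1 : ∀ S, posProj (affineUnitary A s ℓ * S * (affineUnitary A s ℓ)ᴴ) =
      conjHom _ hV (posProj S) := by
    intro S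
    simp [posProj, conjHom, Matrix.mul_add, Matrix.add_mul, unitary_mul_conjTranspose hV]
  rw [CSSCode.projector, ← prod_posProj_eq_standardProjector]
  simp only [affineCode, h1]
  change _ = conjHom _ hV _
  rw [map_list_prod, List.map_ofFn]
  rfl

theorem affineCode_codeProjection (ρ : Op (Fin n)) :
    (affineCode hr t hrn A s ℓ).codeProjection (affineUnitary A s ℓ) ρ =
      partialTrace (relabel (split hr).symm (standardProjector hr t *
        ((affineUnitary A s ℓ)ᴴ * ρ * affineUnitary A s ℓ) * standardProjector hr t)) := by
  have hV := unitary_conjTranspose_mul (affineUnitary_mem_unitaryGroup A s ℓ)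
  have h : ∀ V Q : Op (Fin n), Vᴴ * V = 1 →
      Vᴴ * ((V * Q * Vᴴ) * ρ * (V * Q * Vᴴ)) * V = Q * (Vᴴ * ρ * V) * Q := by
    intro V Q hV
    simp only [Matrix.mul_assoc, hV, Matrix.mul_one]
    rw [← Matrix.mul_assoc Vᴴ V, hV, Matrix.one_mul]
  rw [CSSCode.codeProjection, affineCode_projector, h _ _ hV]

end Decoding

/-! ### Normal form of a single Kraus operator -/

/-- Code projections, followed by the preparation of further qubits in a pure CSS state and
a completely CSS-preserving unitary, with a weight at most `1`. -/
def weightedCodeProjections (n k : ℕ) : Set (Op (Fin n) → Op (Fin k)) :=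
  {F | ∃ (p : ℝ) (r : ℕ) (hr : r ≤ k) (C : CSSCode n r) (V : Op (Fin n)) (φ : Ket (Fin (k - r)))
    (U : Op (Fin k)), (0 ≤ p ∧ p ≤ 1) ∧ C.IsEncodingUnitary V ∧ IsPureCSSState φ ∧
      IsCompletelyCSSPreservingUnitary U ∧ ∀ ρ, F ρ = p • conjBy U
        (relabel (split hr) (tensor (C.codeProjection V ρ) (ketbra φ)))}

/-- Standard states are constant on a coordinate subspace, so `standardKraus` is a multiple of the
indicator of a relation in normal form. -/
theorem standardKet_eq {m : ℕ} (t : Fin m → Bool) : ∃ c : ℂ, c ≠ 0 ∧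
    ∀ z, standardKet t z = if ∀ i, t i = false → z i = 0 then c else 0 := by
  refine ⟨∏ i, if t i then (((√2)⁻¹ : ℝ) : ℂ) else 1, ?_, fun z => ?_⟩
  · rw [Finset.prod_ne_zero_iff]
    intro i _
    split_ifs <;> simp
  · split_ifs with h
    · refine Finset.prod_congr rfl fun i _ => ?_
      rcases hi : t i
      · simp [qubitKet, h i hi]
      · simp [qubitKet]
    · push Not at h
      obtain ⟨i, hi, hz⟩ := h
      exact Finset.prod_eq_zero (Finset.mem_univ i) (by simp [qubitKet, hi, hz])

theorem IsAffineSignMatrix.exists_eq_standardKraus {n k : ℕ}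
    {K : Matrix (Fin k → ZMod 2) (Fin n → ZMod 2) ℂ} (hK : IsAffineSignMatrix K) :
    ∃ (c : ℂ) (r : ℕ) (hr : r ≤ n) (hk : r ≤ k) (t : Fin (n - r) → Bool) (u : Fin (k - r) → Bool)
      (A : (Fin n → ZMod 2) ≃ₗ[ZMod 2] (Fin n → ZMod 2)) (s ℓ : Fin n → ZMod 2)
      (B : (Fin k → ZMod 2) ≃ₗ[ZMod 2] (Fin k → ZMod 2)) (s' ℓ' : Fin k → ZMod 2),
      K = c • (affineUnitary B s' ℓ' * standardKraus hr t hk u * (affineUnitary A s ℓ)ᴴ) := by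
  -- Matrix indices put the output first; the linear relation is taken from inputs to outputs.
  have hswap := IsAffineSign.comp hK
    (AddEquiv.prodComm (M := Fin n → ZMod 2) (N := Fin k → ZMod 2)).toAddMonoidHom
  obtain ⟨c, ⟨s, s'⟩, L, m, hin, hout⟩ := hswap.exists_eq
  obtain ⟨C, N, D, M, R, eV, eW, hL⟩ := exists_linear_relation_normal_form L
  let b := (Module.finBasis (ZMod 2) C).equivFun
  obtain ⟨hr, A, t, hA⟩ := exists_adapted_coordinates eV b
  obtain ⟨hk, B, u, hB⟩ := exists_adapted_coordinates eW b
  obtain ⟨ℓ, hℓ⟩ := exists_dotProduct_eq (m ∘ₗ LinearMap.inl (ZMod 2) _ _)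
  obtain ⟨ℓ', hℓ'⟩ := exists_dotProduct_eq (m ∘ₗ LinearMap.inr (ZMod 2) _ _)
  obtain ⟨a, ha, hat⟩ := standardKet_eq t
  obtain ⟨a', ha', hau⟩ := standardKet_eq u
  -- Dividing by `a'` and `a` removes the normalizations of the two standard states. The base point
  -- `(s, s')` of the support supplies the shifts, and the two halves of the functional `m` supply
  -- the `Z` signs.
  refine ⟨c / (a' * a), _, hr, hk, t, u, A, s, ℓ, B, s', ℓ', ?_⟩
  ext y x
  have hR : (affineUnitary B s' ℓ' * standardKraus hr t hk u * (affineUnitary A s ℓ)ᴴ) y x =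
      sgn (ℓ' ⬝ᵥ y) * standardKraus hr t hk u (B (y + s')) (A (x + s)) * sgn (ℓ ⬝ᵥ x) := by
    rw [Matrix.mul_apply, Finset.sum_eq_single (A (x + s)), Matrix.mul_apply,
      Finset.sum_eq_single (B (y + s'))]
    · simp [affineUnitary, Matrix.conjTranspose_apply]
    · intro w _ hw
      simp only [affineUnitary, Matrix.of_apply, if_neg hw.symm, mul_zero, zero_mul]
    · simp
    · intro w _ hw
      simp only [affineUnitary, Matrix.of_apply, Matrix.conjTranspose_apply, if_neg hw.symm,
        mul_zero, star_zero]
    · simp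
  have hmem : (x, y) - (s, s') ∈ L ↔
      A (x + s) ∘ split hr ∘ Sum.inl = B (y + s') ∘ split hk ∘ Sum.inl ∧
      (∀ i, t i = false → A (x + s) (split hr (Sum.inr i)) = 0) ∧
      ∀ i, u i = false → B (y + s') (split hk (Sum.inr i)) = 0 := by
    rw [Prod.mk_sub_mk, bits_sub_eq_add, bits_sub_eq_add, hL, (hA _).1, (hB _).1, (hA _).2,
      (hB _).2, b.injective.eq_iff]
  have hm : m (x, y) = ℓ ⬝ᵥ x + ℓ' ⬝ᵥ y := by
    rw [← hℓ, ← hℓ']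
    simp [← map_add]
  rw [Matrix.smul_apply, hR, standardKraus, Matrix.of_apply, hat, hau]
  simp only [Function.comp_apply]
  by_cases h : (x, y) - (s, s') ∈ L
  · have e : K y x = c * sgn (m (x, y)) := hin _ h
    obtain ⟨h1, h2, h3⟩ := hmem.1 h
    rw [e, if_pos h1.symm, if_pos h3, if_pos h2, hm, sgn_add, smul_eq_mul]
    field_simp
  · have e : K y x = 0 := hout _ h
    rw [e]
    rw [hmem] at h
    by_cases h1 : A (x + s) ∘ split hr ∘ Sum.inl = B (y + s') ∘ split hk ∘ Sum.inl
    · by_cases h2 : ∀ i, t i = false → A (x + s) (split hr (Sum.inr i)) = 0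
      · have h3 : ¬ ∀ i, u i = false → B (y + s') (split hk (Sum.inr i)) = 0 :=
          fun h3 => h ⟨h1, h2, h3⟩
        rw [if_pos h1.symm, if_neg h3]; simp
      · rw [if_pos h1.symm, if_neg (c := ∀ i, t i = false → _) h2]; simp
    · rw [if_neg fun e => h1 e.symm]; simp

theorem krausMap_mem_closure_weightedCodeProjections {n k : ℕ} (hkn : k < n)
    {K : Matrix (Fin k → ZMod 2) (Fin n → ZMod 2) ℂ} (hK : IsAffineSignMatrix K) :
    krausMap K ∈ AddSubmonoid.closure (weightedCodeProjections n k) := by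
  obtain ⟨c, r, hr, hk, t, u, A, s, ℓ, B, s', ℓ', rfl⟩ := hK.exists_eq_standardKraus
  -- The weight `‖c‖ ^ 2` may exceed one, so it is divided among `N` equal copies of the same term.
  obtain ⟨N, hN⟩ := exists_nat_gt (‖c‖ ^ 2)
  have hN0 : (0 : ℝ) < N := (sq_nonneg _).trans_lt hN
  let F : Op (Fin n) → Op (Fin k) := fun ρ => (‖c‖ ^ 2 / N) • conjBy (affineUnitary B s' ℓ')
    (relabel (split hk) (tensor ((affineCode hr t (hk.trans_lt hkn) A s ℓ).codeProjection
      (affineUnitary A s ℓ) ρ) (ketbra (standardKet u))))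
  have hF : F ∈ weightedCodeProjections n k :=
    ⟨_, r, hk, _, _, _, _, ⟨by positivity, (div_le_one hN0).2 hN.le⟩,
      affineCode_isEncodingUnitary hr t (hk.trans_lt hkn) A s ℓ, standardKet_isPureCSSState u,
      affineUnitary_preserving B s' ℓ', fun ρ => rfl⟩
  convert AddSubmonoid.nsmul_mem _ (AddSubmonoid.subset_closure hF) N using 1
  funext ρ
  rw [Pi.smul_apply, ← Nat.cast_smul_eq_nsmul ℝ, smul_smul, mul_div_cancel₀ _ hN0.ne',
    affineCode_codeProjection, ← krausMap_standardKraus]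
  have hc : c * star c = ((‖c‖ ^ 2 : ℝ) : ℂ) := by
    rw [Complex.star_def, Complex.mul_conj, Complex.normSq_eq_norm_sq]
  have hsmul : ∀ M : Op (Fin k), ((‖c‖ ^ 2 : ℝ) : ℂ) • M = (‖c‖ ^ 2 : ℝ) • M := fun M => rfl
  rw [← hsmul, ← hc]
  simp only [krausMap, conjBy, Matrix.conjTranspose_smul, Matrix.conjTranspose_mul,
    Matrix.conjTranspose_conjTranspose, Matrix.smul_mul, Matrix.mul_smul, smul_smul,
    Matrix.mul_assoc]
  rw [mul_comm]

end CSSDistillation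

end

/-! ### Assembly of the decomposition -/

theorem mainTheorem5 (n k : ℕ) (hn : 2 ≤ n) (hk : 1 ≤ k) (hkn : k < n)
    (E : CSSDistillation.Op (Fin n) → CSSDistillation.Op (Fin k))
    (hE : CSSDistillation.IsCSSCircuit E) :
    ∃ (N : ℕ) (p : Fin N → ℝ) (κ : Fin N → ℕ) (hκ : ∀ j, κ j ≤ k)
      (C : ∀ j, CSSDistillation.CSSCode n (κ j))
      (V : Fin N → CSSDistillation.Op (Fin n))
      (φ : ∀ j, CSSDistillation.Ket (Fin (k - κ j)))
      (U : Fin N → CSSDistillation.Op (Fin k)),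
      (∀ j, 0 ≤ p j ∧ p j ≤ 1) ∧
      (∀ j, (C j).IsEncodingUnitary (V j)) ∧
      (∀ j, CSSDistillation.IsPureCSSState (φ j)) ∧
      (∀ j, CSSDistillation.IsCompletelyCSSPreservingUnitary (U j)) ∧
      ∀ ρ : CSSDistillation.Op (Fin n),
        E ρ = ∑ j, p j • CSSDistillation.conjBy (U j)
          (CSSDistillation.relabel (CSSDistillation.split (hκ j))
            (CSSDistillation.tensor ((C j).codeProjection (V j) ρ)
              (CSSDistillation.ketbra (φ j)))) := by
  have hle : CSSDistillation.affineKrausMaps (Fin n) (Fin k) ≤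
      AddSubmonoid.closure (CSSDistillation.weightedCodeProjections n k) := by
    refine AddSubmonoid.closure_le.2 ?_
    rintro _ ⟨K, hK, rfl⟩
    exact CSSDistillation.krausMap_mem_closure_weightedCodeProjections hkn hK
  -- The family is indexed by positions in a list, so repeated terms remain separate.
  obtain ⟨l, hl, hsum⟩ := AddSubmonoid.exists_list_of_mem_closure (hle hE.mem_affineKrausMaps)
  have hl' : ∀ j : Fin l.length, l.get j ∈ CSSDistillation.weightedCodeProjections n k :=
    fun j => hl _ (l.get_mem j)
  choose p κ hκ C V φ U hp hV hφ hU h using hl'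
  refine ⟨l.length, p, κ, hκ, C, V, φ, U, hp, hV, hφ, hU, fun ρ => ?_⟩
  have hE' : E = ∑ j, l.get j := by
    rw [← hsum, ← List.sum_ofFn, List.ofFn_get]
  rw [hE', Finset.sum_apply]
  exact Finset.sum_congr rfl fun j _ => h j ρ
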